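/- **Setting.** Let $G=(V,E)$ be a finite simple undirected planar three-connected graph (it stays connected after the removal of any two vertices) of order $n>4$, and let $\Gamma\subset V$ be the set of vertices of some face of $G$. Let $L_G\in\mathbb{R}^{V\times V}$ be the graph Laplacian of $G$, and write it in blocks with respect to the interior $o=V\setminus\Gamma$ and the boundary $\Gamma$. Let $$S_\Gamma=(L_G)_{\Gamma\Gamma}-(L_G)_{\Gamma o}\,\big((L_G)_{oo}\big)^{-1}(L_G)_{o\Gamma}$$ be the Schur complement with respect to the interior vertices, let $L_\Gamma$ be the Laplacian of the induced subgraph $G[\Gamma]$ (a cycle), and let $L_\Gamma^{1/2}$ be its positive semidefinite square root. For integers $k,\ell$ let $G_{k,\ell}=C_k\,\square\,P_\ell$ be the Cartesian product of the cycle on $k$ vertices and the path on $\ell$ vertices, with vertices $(i,j)$, $1\le i\le k$, $1\le j\le\ell$ (the index $i$ is taken modulo $k$), and let $G^*_{k,\ell}$ be the graph obtained from $G_{k,\ell}$ by adding all edges $\{(i,j),(i-1,j+1)\}$ and $\{(i,j),(i+1,j+1)\}$, $1\le i\le k$, $1\le j\le\ell-1$. A graph $H$ with $G_{k,\ell}\subset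 H\subset G^*_{k,\ell}$ is an *$M$-aggregation* of $(G,\Gamma)$, $M\in\mathbb{N}$, if $V$ is the disjoint union of a (possibly empty) set $a_*$ and sets $a_{i,j}$, $1\le i\le k$, $1\le j\le\ell$, such that 1. $G[a_{i,j}]$ is connected and $|a_{i,j}|\le M$ for all $i,j$; 2. $\Gamma\subset\bigcup_{i=1}^k a_{i,1}$, and $\Gamma\cap a_{i,1}\neq\emptyset$ for all $i$; 3. every neighbor of a vertex of $a_*$ lies in $a_*\cup\bigcup_{i=1}^k a_{i,\ell}$; 4. $(i,j)\mapsto a_{i,j}$ is an isomorphism from $H$ onto the aggregation graph, whose vertices are the sets $a_{i,j}$, two distinct ones being adjacent if and only if some edge of $G$ joins them. **Theorem.** Let $k,\ell,c,M\in\mathbb{N}$ with $\ell\ge 2$ and $4\ell<k<2c\ell$, and suppose that some graph $H$ with $G_{k,\ell}\subset H\subset G^*_{k,\ell}$ is an $M$-aggregation of $(G,\Gamma)$. Then, for every $\varphi\in\mathbb{R}^\Gamma$, $$\frac{1}{36M^2(M+3)\max\{3c,4\pi^2\}\left(\frac{2}{3\pi}+\frac{\sqrt2}{27}\right)}\,\langle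 L_\Gamma^{1/2}\varphi,\varphi\rangle\;\le\;\langle S_\Gamma\varphi,\varphi\rangle\;\le\;\frac{784\,M^4(3c+20)}{\frac{1}{2\pi}-\frac{\sqrt2}{12}}\,\langle L_\Gamma^{1/2}\varphi,\varphi\rangle .$$ In particular, the two constants depend only on $M$ and $c$ and not on $n$. -/

import Mathlib

namespace GraphTrace

open SimpleGraph

/-! ### Planar three-connected graphs with a distinguished face -/

/-- `G` remains connected upon the removal of any set of at most two vertices. -/
def ThreeConnected {V : Type*} (G : SimpleGraph V) : Prop :=
  ∀ s : Finset V, s.card ≤ 2 → (G.induce {v | v ∉ s}).Connected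

/-- A combinatorial embedding (rotation system) of a graph in an oriented surface: for each vertex,
a cyclic ordering of the darts (oriented edges) that leave it, given by the permutation `next`,
whose cycles are exactly the sets of darts with a common origin. -/
structure RotationSystem {V : Type*} (G : SimpleGraph V) where
  /-- the dart that follows a given one in the cyclic order around their common origin -/
  next : Equiv.Perm G.Dart
  next_fst : ∀ d : G.Dart, (next d).fst = d.fst
  sameCycle_of_fst_eq : ∀ d d' : G.Dart, d.fst = d'.fst → next.SameCycle d d'

namespace RotationSystem

variable {V : Type*} {G : SimpleGraph V} (R : RotationSystem G)

/-- Face tracing: traverse the dart `d`, then leave its endpoint by the dart that follows the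
reversal of `d`. The orbits of this permutation are the boundary walks of the faces. -/
def faceStep : Equiv.Perm G.Dart :=
  (Dart.symm_involutive (G := G)).toPerm.trans R.next

/-- The faces of the embedding: the orbits of the face tracing permutation. -/
def Face : Type _ := Quotient (Equiv.Perm.SameCycle.setoid R.faceStep)

/-- The vertices of the face whose boundary walk contains the dart `d`. -/
def faceVertices (d : G.Dart) : Set V :=
  {v | ∃ d' : G.Dart, R.faceStep.SameCycle d d' ∧ d'.fst = v}

/-- Euler's formula `|V| - |E| + |F| = 2`: for a finite connected graph with at least one edge, the
surface of the rotation system is the sphere, so that the embedding is a planar one. -/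
def IsPlanar : Prop :=
  (Nat.card V : ℤ) - (Nat.card G.edgeSet : ℤ) + (Nat.card R.Face : ℤ) = 2

end RotationSystem

/-- `(G, Γ)` belongs to the class of pairs of a planar three-connected simple graph of order greater
than four and the vertex set of one of its faces. -/
structure IsPlanarPair {V : Type*} (G : SimpleGraph V) (Γ : Set V) : Prop where
  four_lt_card : 4 < Nat.card V
  threeConnected : ThreeConnected G
  exists_face : ∃ R : RotationSystem G, R.IsPlanar ∧ ∃ d : G.Dart, Γ = R.faceVertices d

/-! ### The graphs `G_{k,ℓ}`, `G*_{k,ℓ}` and aggregations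

The vertex `(i, j)`, `1 ≤ i ≤ k`, `1 ≤ j ≤ ℓ`, is represented by `(i - 1, j - 1) : Fin k × Fin ℓ`. -/

/-- `G_{k,ℓ}`, the Cartesian product of the `k`-cycle and the path on `ℓ` vertices. -/
def annulus (k ℓ : ℕ) : SimpleGraph (Fin k × Fin ℓ) :=
  cycleGraph k □ pathGraph ℓ

/-- `G*_{k,ℓ}`: the graph `G_{k,ℓ}` with the diagonals `{(i, j), (i - 1, j + 1)}` and
`{(i, j), (i + 1, j + 1)}` (first coordinate modulo `k`) of all its squares added. -/
def annulusStar (k ℓ : ℕ) : SimpleGraph (Fin k × Fin ℓ) :=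
  annulus k ℓ ⊔ SimpleGraph.fromRel fun x y =>
    (cycleGraph k).Adj x.1 y.1 ∧ (y.2 : ℕ) = (x.2 : ℕ) + 1

/-- The aggregation graph of a family of vertex sets: two distinct members are adjacent if some
edge of `G` joins them. -/
def aggregationGraph {V ι : Type*} (G : SimpleGraph V) (a : ι → Set V) : SimpleGraph ι where
  Adj x y := x ≠ y ∧ ∃ p ∈ a x, ∃ q ∈ a y, G.Adj p q
  symm := by
    constructor
    rintro x y ⟨hne, p, hp, q, hq, h⟩
    exact ⟨hne.symm, q, hq, p, hp, h.symm⟩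
  loopless := by
    constructor
    rintro x ⟨hne, -⟩
    exact hne rfl

/-- The sets `aStar` and `a (i, j)` form a partition of the vertex set of `G` that exhibits `H` as an
`M`-aggregation of `(G, Γ)`; the aggregate `a (i, j)` corresponds to the vertex `(i, j)` of `H`. -/
structure IsAggregationPartition {V : Type*} (M : ℕ) (G : SimpleGraph V) (Γ : Set V) {k ℓ : ℕ}
    (H : SimpleGraph (Fin k × Fin ℓ)) (aStar : Set V) (a : Fin k × Fin ℓ → Set V) : Prop where
  union_eq : aStar ∪ ⋃ x, a x = Set.univ
  disjoint_star : ∀ x, Disjoint aStar (a x)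
  disjoint : ∀ x y, x ≠ y → Disjoint (a x) (a y)
  connected : ∀ x, (G.induce (a x)).Connected
  ncard_le : ∀ x, (a x).ncard ≤ M
  boundary_subset : ∀ p ∈ Γ, ∃ x : Fin k × Fin ℓ, (x.2 : ℕ) = 0 ∧ p ∈ a x
  boundary_inter : ∀ x : Fin k × Fin ℓ, (x.2 : ℕ) = 0 → (Γ ∩ a x).Nonempty
  star_neighbors : ∀ p ∈ aStar, ∀ q, G.Adj p q →
    q ∈ aStar ∨ ∃ x : Fin k × Fin ℓ, (x.2 : ℕ) + 1 = ℓ ∧ q ∈ a x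
  aggregationGraph_eq : aggregationGraph G a = H

/-- `H` is an `M`-aggregation of `(G, Γ)`. -/
def IsAggregation {V : Type*} (M : ℕ) (G : SimpleGraph V) (Γ : Set V) {k ℓ : ℕ}
    (H : SimpleGraph (Fin k × Fin ℓ)) : Prop :=
  ∃ (aStar : Set V) (a : Fin k × Fin ℓ → Set V), IsAggregationPartition M G Γ H aStar a

/-! ### The Schur complement and the square root of the boundary Laplacian -/

noncomputable section

open Classical in
/-- The Schur complement `S_Γ` of the graph Laplacian of `G` with respect to the interior vertices
`V \ Γ`, that is, `L_ΓΓ - L_Γo (L_oo)⁻¹ L_oΓ` where `o = V \ Γ`. -/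
def schurComplement {V : Type*} [Fintype V] (G : SimpleGraph V) (Γ : Set V) : Matrix Γ Γ ℝ :=
  let L : Matrix V V ℝ := G.lapMatrix ℝ
  L.toBlock (· ∈ Γ) (· ∈ Γ) -
    L.toBlock (· ∈ Γ) (· ∉ Γ) * (L.toBlock (· ∉ Γ) (· ∉ Γ))⁻¹ * L.toBlock (· ∉ Γ) (· ∈ Γ)

open Classical in
/-- `L_Γ^{1/2}`: the positive semidefinite square root (through the functional calculus of
Hermitian matrices) of the Laplacian `L_Γ` of the induced subgraph `G[Γ]`. -/
def sqrtBoundaryLaplacian {V : Type*} [Fintype V] (G : SimpleGraph V) (Γ : Set V) :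
    Matrix Γ Γ ℝ :=
  cfc Real.sqrt ((G.induce Γ).lapMatrix ℝ)

open Classical in
/-- The quadratic form `⟨A φ, φ⟩` of a matrix. -/
def quadForm {V : Type*} [Fintype V] {Γ : Set V} (A : Matrix Γ Γ ℝ) (φ : Γ → ℝ) : ℝ :=
  A.mulVec φ ⬝ᵥ φ

end

end GraphTrace

/-! By Dirichlet's principle `⟨S_Γ φ, φ⟩` is the least energy of an extension of `φ` to `V`
(`quadForm_schurComplement_le`, `exists_energy_eq_quadForm`). The theorem is thus a trace and
extension theorem for a discrete `H^{1/2}` seminorm, with the rows of aggregates as depth. Write `B`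
for `L_Γ^{1/2}`, so that `|B x|²` is the energy of `x` on `G[Γ]`.

Trace (`sqrt_form_le_energy`): sample `u` at one vertex of each aggregate and spread each row of
samples over `Γ`. Between consecutive layers `x`, `y` the form of `B` changes by `⟨x - y, B x + B
y⟩`, hence by at most the vertical energy plus the mean of the two horizontal ones. Telescoping down
to the row of least horizontal energy leaves an end term, bounded by a Poincaré inequality on the
cycle of columns; `k < 2cℓ` makes it comparable with the energy.

Extension (`exists_extension`): the Euler steps `v ↦ v - τ B v`, a discrete `exp(-tB)`, times a
linear cutoff, define the extension row by row. Each step lowers the form of `B` by at least `τ |B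
v|²`, so the sum of these energies over all rows is bounded by the initial form. The cutoff costs a
multiple of `|ψ|² / ℓ`, with `ψ` the part of `φ` of mean zero; the spectral gap bounds it by a
multiple of `kM / ℓ` times the form.

The extension compares boundary values in neighboring columns, so the boundary vertices in two
consecutive columns must be joined inside `G[Γ]` (`preconnected_window`). This is where planarity
enters: Euler's formula makes every circulation a difference of face potentials
(`exists_faceDiff_of_divergence_eq_zero`), hence two disjoint connected sets cannot interleave along
a face (`not_cross`). The constants so obtained imply the stated ones. -/

namespace GraphTrace

open SimpleGraph

/-! ### Circulations on a planar rotation system -/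

section Planarity

open scoped Classical

set_option linter.unusedSectionVars false

variable {V : Type*} [Fintype V] {G : SimpleGraph V}

/-- The net amount of the flow `z` that leaves the vertex `v`. -/
noncomputable def divergence (z : G.Dart → ℝ) (v : V) : ℝ :=
  ∑ d : G.Dart, if d.fst = v then z d else 0

theorem divergence_add (z z' : G.Dart → ℝ) (v : V) :
    divergence (fun d => z d + z' d) v = divergence z v + divergence z' v := by
  simp only [divergence, ← Finset.sum_add_distrib, ite_add_ite, add_zero]

theorem divergence_sub (z z' : G.Dart → ℝ) (v : V) :
    divergence (fun d => z d - z' d) v = divergence z v - divergence z' v := by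
  simp only [divergence, ← Finset.sum_sub_distrib, ite_sub_ite, sub_zero]

theorem divergence_single (e : G.Dart) (v : V) :
    divergence (fun d => if d = e then 1 else 0) v = if e.fst = v then 1 else 0 := by
  unfold divergence
  rw [Finset.sum_eq_single e (fun d _ hd => by simp [hd]) (by simp)]
  simp

/-- An antisymmetric flow without divergence is orthogonal to gradients. -/
theorem sum_mul_gradient_eq_zero {z : G.Dart → ℝ} (hz : ∀ d, z d.symm = -z d)
    (hdiv : ∀ v, divergence z v = 0) (g : V → ℝ) :
    ∑ d : G.Dart, z d * (g d.fst - g d.snd) = 0 := by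
  have h1 : ∑ d : G.Dart, z d * g d.fst = 0 := by
    have : ∑ v, g v * divergence z v = ∑ d : G.Dart, z d * g d.fst := by
      simp only [divergence, Finset.mul_sum, mul_ite, mul_zero]
      rw [Finset.sum_comm]
      refine Finset.sum_congr rfl fun d _ => ?_
      simp [mul_comm]
    rw [← this]
    simp [hdiv]
  have h2 : ∑ d : G.Dart, z d * g d.snd = -∑ d : G.Dart, z d * g d.fst := by
    rw [← Equiv.sum_comp (Dart.symm_involutive (G := G)).toPerm, ← Finset.sum_neg_distrib]
    refine Finset.sum_congr rfl fun d _ => ?_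
    simp [hz]
  simp only [mul_sub, Finset.sum_sub_distrib]
  rw [h2, h1]
  simp

/-- Such a gradient is itself a circulation, hence orthogonal to itself. -/
theorem gradient_eq_zero_of_divergence_eq_zero {g : V → ℝ}
    (hdiv : ∀ v, divergence (fun d : G.Dart => g d.fst - g d.snd) v = 0) (d : G.Dart) :
    g d.fst - g d.snd = 0 := by
  have h := sum_mul_gradient_eq_zero (G := G) (z := fun d => g d.fst - g d.snd)
    (fun d => by simp) hdiv g
  rw [Finset.sum_eq_zero_iff_of_nonneg (fun d _ => mul_self_nonneg _)] at h
  exact mul_self_eq_zero.mp (h d (Finset.mem_univ d))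

/-- A unit flow along a walk that stays in `A`. -/
theorem exists_unit_flow {A : Set V} {q p : A} (w : (G.induce A).Walk q p) :
    ∃ P : G.Dart → ℝ, (∀ d, P d.symm = -P d) ∧ (∀ d, d.fst ∉ A → P d = 0) ∧
      ∀ v, divergence P v = (if q.1 = v then 1 else 0) - if p.1 = v then 1 else 0 := by
  induction w with
  | nil => exact ⟨fun _ => 0, by simp, by simp, by simp [divergence]⟩
  | @cons a b c hab w ih =>
    obtain ⟨P, h1, h2, h3⟩ := ih
    let e : G.Dart := ⟨(a.1, b.1), hab⟩
    refine ⟨fun d => ((if d = e then 1 else 0) - if d = e.symm then 1 else 0) + P d, ?_, ?_, ?_⟩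
    · intro d
      have h4 : d.symm = e ↔ d = e.symm :=
        (Dart.symm_involutive (G := G)).eq_iff
      have h5 : d.symm = e.symm ↔ d = e := (Dart.symm_involutive (G := G)).injective.eq_iff
      simp only [h4, h5, h1]
      ring
    · intro d hd
      have h4 : d ≠ e := by rintro rfl; exact hd a.2
      have h5 : d ≠ e.symm := by rintro rfl; exact hd b.2
      simp [h4, h5, h2 d hd]
    · intro v
      rw [divergence_add, divergence_sub, divergence_single, divergence_single, h3]
      change ((if a.1 = v then (1 : ℝ) else 0) - if b.1 = v then 1 else 0) + _ = _
      ring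

/-! ### Face potentials and a discrete Jordan theorem -/

namespace RotationSystem

variable (R : RotationSystem G)

theorem faceStep_apply (d : G.Dart) : R.faceStep d = R.next d.symm := rfl

theorem faceStep_fst (d : G.Dart) : (R.faceStep d).fst = d.snd := by
  rw [faceStep_apply, R.next_fst]; rfl

/-- The face on whose boundary walk a dart lies. -/
def faceOf (d : G.Dart) : R.Face := Quotient.mk _ d

theorem faceOf_faceStep (d : G.Dart) : R.faceOf (R.faceStep d) = R.faceOf d :=
  Quotient.sound (Equiv.Perm.SameCycle.refl _ _).apply_left

theorem faceOf_next (d : G.Dart) : R.faceOf (R.next d) = R.faceOf d.symm := by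
  rw [← R.faceOf_faceStep d.symm, faceStep_apply, Dart.symm_symm]

/-- Summing over the darts at a vertex is invariant under rotation. -/
theorem divergence_comp_next (z : G.Dart → ℝ) (v : V) :
    divergence (fun d => z (R.next d)) v = divergence z v := by
  unfold divergence
  rw [← Equiv.sum_comp R.next (fun d => if d.fst = v then z d else 0)]
  simp only [R.next_fst]

/-- Rotation about `v` carries the face of `d` to that of `d.symm`, so both terms have the same sum
at `v`. -/
theorem divergence_faceDiff (h : R.Face → ℝ) (v : V) :
    divergence (fun d => h (R.faceOf d) - h (R.faceOf d.symm)) v = 0 := by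
  have := R.divergence_comp_next (fun d => h (R.faceOf d)) v
  simp only [R.faceOf_next] at this
  rw [divergence_sub, this, sub_self]

/-- A function on darts that is invariant under rotation and under reversal is constant. -/
theorem eq_of_invariant (hG : G.Preconnected) {α : Type*} {f : G.Dart → α}
    (hnext : ∀ d, f (R.next d) = f d) (hsymm : ∀ d, f d.symm = f d) (d d' : G.Dart) :
    f d = f d' := by
  have hvert : ∀ e e' : G.Dart, e.fst = e'.fst → f e = f e' := by
    intro e e' h
    obtain ⟨n, hn⟩ := (R.sameCycle_of_fst_eq e e' h).exists_nat_pow_eq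
    rw [← hn]
    clear hn
    induction n with
    | zero => rfl
    | succ n ih => rw [pow_succ', Equiv.Perm.mul_apply, hnext, ih]
  have hwalk : ∀ u v : V, G.Walk u v → ∀ e e' : G.Dart, e.fst = u → e'.fst = v → f e = f e' := by
    intro u v w
    induction w with
    | nil => intro e e' h h'; exact hvert _ _ (h.trans h'.symm)
    | @cons u v w h p ih =>
      intro e e' he he'
      rw [hvert e ⟨(u, v), h⟩ he, ← hsymm]
      exact ih _ _ rfl he'
  obtain ⟨w⟩ := hG d.fst d'.fst
  exact hwalk _ _ w d d' rfl rfl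

/-- On the sphere every circulation is the boundary of a function on the faces. -/
theorem exists_faceDiff_of_divergence_eq_zero (hR : R.IsPlanar) (hG : G.Connected)
    {z : G.Dart → ℝ} (hz : ∀ d, z d.symm = -z d) (hdiv : ∀ v, divergence z v = 0) :
    ∃ h : R.Face → ℝ, ∀ d, z d = h (R.faceOf d) - h (R.faceOf d.symm) := by
  have : Finite R.Face := Quotient.finite _
  have : Fintype R.Face := Fintype.ofFinite _
  -- The choice `δ` orients every edge, so antisymmetric flows become functions on edges.
  have hdart : ∀ e : G.edgeSet, ∃ d : G.Dart, d.edge = e := by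
    rintro ⟨e, he⟩
    induction e using Sym2.ind with
    | _ x y => exact ⟨⟨(x, y), he⟩, rfl⟩
  choose δ hδ using hdart
  let T : ((R.Face → ℝ) × (V → ℝ)) →ₗ[ℝ] (G.edgeSet → ℝ) :=
    { toFun := fun x e => x.1 (R.faceOf (δ e)) - x.1 (R.faceOf (δ e).symm) +
        (x.2 (δ e).fst - x.2 (δ e).snd)
      map_add' := by intro x y; ext e; simp; ring
      map_smul' := by intro a x; ext e; simp; ring }
  have hext : ∀ f : G.Dart → ℝ, (∀ d, f d.symm = -f d) → (∀ e, f (δ e) = 0) → ∀ d, f d = 0 := by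
    intro f hf h0 d
    have := hδ ⟨d.edge, d.edge_mem⟩
    rcases (dart_edge_eq_iff _ _).mp this with h | h
    · rw [← h]; exact h0 _
    · have h' := hf d
      rw [← h, h0] at h'
      linarith
  obtain ⟨v₀⟩ := hG.nonempty
  -- Face differences and gradients are orthogonal, so both vanish for an element of the kernel;
  -- only a constant on the faces and a constant on the vertices remain.
  have hker : Module.finrank ℝ (LinearMap.ker T) ≤ 2 := by
    let ev : LinearMap.ker T →ₗ[ℝ] (ℝ × ℝ) :=
      { toFun := fun x => (if h : Nonempty G.Dart then x.1.1 (R.faceOf h.some) else 0, x.1.2 v₀)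
        map_add' := by intro x y; split_ifs <;> simp
        map_smul' := by intro a x; split_ifs <;> simp }
    have hev : Function.Injective ev := by
      rw [injective_iff_map_eq_zero]
      rintro ⟨⟨h, g⟩, hx⟩ h0
      have hT : ∀ d : G.Dart, h (R.faceOf d) - h (R.faceOf d.symm) + (g d.fst - g d.snd) = 0 := by
        refine hext _ (fun d => by simp [add_comm]) fun e => ?_
        exact congrFun (LinearMap.mem_ker.mp hx) e
      have hg0 : ∀ d : G.Dart, g d.fst - g d.snd = 0 := by
        refine gradient_eq_zero_of_divergence_eq_zero fun v => ?_
        have h1 := R.divergence_faceDiff h v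
        have h2 : (fun d : G.Dart => g d.fst - g d.snd) =
            fun d => 0 - (h (R.faceOf d) - h (R.faceOf d.symm)) := by
          funext d
          linarith [hT d]
        rw [h2, divergence_sub, h1]
        simp [divergence]
      have hg : ∀ v, g v = g v₀ := by
        intro v
        obtain ⟨w⟩ := hG.preconnected v v₀
        induction w with
        | nil => rfl
        | @cons a b c hab p ih =>
          have := hg0 ⟨(a, b), hab⟩
          simp only at this
          have h' := ih
            (by simpa [ev] using h0)
          linarith
      have hh : ∀ d d' : G.Dart, h (R.faceOf d) = h (R.faceOf d') := by
        have hs : ∀ d : G.Dart, h (R.faceOf d.symm) = h (R.faceOf d) := fun d => by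
          linarith [hT d, hg0 d]
        refine R.eq_of_invariant hG.preconnected (f := fun d => h (R.faceOf d)) (fun d => ?_) hs
        simp only [faceOf_next, hs]
      simp only [ev, LinearMap.coe_mk, AddHom.coe_mk, Prod.mk_eq_zero] at h0
      have hg' : g = 0 := funext fun v => (hg v).trans h0.2
      have hh' : h = 0 := by
        funext f
        induction f using Quotient.ind with
        | _ d =>
          have hne : Nonempty G.Dart := ⟨d⟩
          rw [dif_pos hne] at h0
          exact (hh d hne.some).trans h0.1
      simp [hg', hh']
    simpa using LinearMap.finrank_le_finrank_of_injective hev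
  have hsurj : Function.Surjective T := by
    rw [← LinearMap.range_eq_top]
    apply Submodule.eq_top_of_finrank_eq
    have h1 := T.finrank_range_add_finrank_ker
    have h2 := Submodule.finrank_le (LinearMap.range T)
    -- Rank at least `|F| + |V| - 2`, which is `|E|` by Euler's formula.
    have h3 := hR
    unfold IsPlanar at h3
    rw [Nat.card_eq_fintype_card, Nat.card_eq_fintype_card, Nat.card_eq_fintype_card] at h3
    simp only [Module.finrank_prod, Module.finrank_fintype_fun_eq_card] at h1 h2 ⊢
    omega
  obtain ⟨⟨h, g⟩, hhg⟩ := hsurj fun e => z (δ e)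
  have hT : ∀ d : G.Dart,
      h (R.faceOf d) - h (R.faceOf d.symm) + (g d.fst - g d.snd) - z d = 0 := by
    refine hext _ (fun d => by simp [hz]; ring) fun e => ?_
    have := congrFun hhg e
    simp only [T, LinearMap.coe_mk, AddHom.coe_mk] at this
    rw [this, sub_self]
  -- The gradient part of `z` is a difference of two circulations, hence zero.
  have hg0 : ∀ d : G.Dart, g d.fst - g d.snd = 0 := by
    refine gradient_eq_zero_of_divergence_eq_zero fun v => ?_
    have h1 := R.divergence_faceDiff h v
    have h2 := hdiv v
    have h3 : (fun d : G.Dart => g d.fst - g d.snd) =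
        fun d => z d - (h (R.faceOf d) - h (R.faceOf d.symm)) := by
      funext d
      linarith [hT d]
    rw [h3, divergence_sub, h1, h2, sub_self]
  exact ⟨h, fun d => by linarith [hT d, hg0 d]⟩

/-- Two disjoint connected sets do not cross in a face: if the arc `α` of a boundary walk begins at
the dart `dp` and ends before the dart `dq`, both with origin in the connected set `A`, then a
connected set disjoint from `A` cannot contain the origins of a dart in `α` and of another dart of
the same face outside of `α`. -/
theorem not_cross (hR : R.IsPlanar) (hG : G.Connected) {A A' : Set V}
    (hA : (G.induce A).Preconnected) (hA' : (G.induce A').Preconnected) (hAA' : Disjoint A A')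
    {α : Set G.Dart} {dp dq : G.Dart} (hpA : dp.fst ∈ A) (hqA : dq.fst ∈ A)
    (hp : dp ∈ α) (hp' : R.faceStep.symm dp ∉ α) (hq : dq ∉ α) (hq' : R.faceStep.symm dq ∈ α)
    (hα : ∀ e, R.faceStep e ≠ dp → R.faceStep e ≠ dq → (R.faceStep e ∈ α ↔ e ∈ α))
    {x y : G.Dart} (hxy : R.faceOf x = R.faceOf y) (hx : x ∈ α) (hy : y ∉ α) (hxA : x.fst ∈ A')
    (hyA : y.fst ∈ A') : False := by
  -- The flow from `dq.fst` to `dp.fst` inside `A` closes the arc `α` to a circulation: the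
  -- indicator of `α` jumps only at `dp` and `dq`.
  obtain ⟨w⟩ := hA ⟨_, hqA⟩ ⟨_, hpA⟩
  obtain ⟨P, hP1, hP2, hP3⟩ := exists_unit_flow w
  have hP2' : ∀ d : G.Dart, d.snd ∉ A → P d = 0 := fun d hd => by
    have := hP2 d.symm hd
    rw [hP1] at this
    linarith
  let ind : G.Dart → ℝ := fun d => if d ∈ α then 1 else 0
  have hstep : ∀ d, ind d - ind (R.faceStep.symm d) =
      (if d = dp then 1 else 0) - if d = dq then 1 else 0 := by
    intro d
    have hpq : dp ≠ dq := by rintro rfl; exact hq hp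
    by_cases h1 : d = dp
    · subst h1; simp [ind, hp, hp', hpq]
    by_cases h2 : d = dq
    · subst h2; simp [ind, hq, hq', hpq.symm]
    have := hα (R.faceStep.symm d) (by simpa using h1) (by simpa using h2)
    simp only [Equiv.apply_symm_apply] at this
    simp [ind, this, h1, h2]
  have hsymm : ∀ d, R.faceStep.symm (R.next d) = d.symm := fun d => by
    rw [Equiv.symm_apply_eq, faceStep_apply, Dart.symm_symm]
  have hdiv : ∀ v, divergence (fun d => (ind d - ind d.symm) + P d) v = 0 := by
    intro v
    have h1 := R.divergence_comp_next (fun d => ind (R.faceStep.symm d)) v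
    simp only [hsymm] at h1
    rw [divergence_add, divergence_sub, h1, ← divergence_sub]
    simp only [hstep]
    rw [divergence_sub, divergence_single, divergence_single, hP3]
    ring
  obtain ⟨h, hh⟩ := R.exists_faceDiff_of_divergence_eq_zero hR hG
    (fun d => by simp only [hP1, Dart.symm_symm]; ring) hdiv
  -- Away from `A` the flow `P` vanishes, so `h'` is invariant under reversal and rotation and is
  -- constant along `A'`. But `x` and `y` share a face, while their indicators are `1` and `0`.
  let h' : G.Dart → ℝ := fun d => h (R.faceOf d) - ind d
  have hh' : ∀ d, P d = h' d - h' d.symm := fun d => by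
    simp only [h']
    linarith [hh d]
  have hsym : ∀ d : G.Dart, d.fst ∉ A ∨ d.snd ∉ A → h' d.symm = h' d := by
    rintro d (hd | hd)
    · linarith [hh' d, hP2 d hd]
    · linarith [hh' d, hP2' d hd]
  have hnext : ∀ d : G.Dart, d.fst ∉ A → h' (R.next d) = h' d := by
    intro d hd
    rw [← hsym d (Or.inl hd)]
    have h1 : R.next d ≠ dp := fun h => hd (by rw [← R.next_fst, h]; exact hpA)
    have h2 : R.next d ≠ dq := fun h => hd (by rw [← R.next_fst, h]; exact hqA)
    have h3 := hstep (R.next d)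
    rw [hsymm] at h3
    simp only [h1, h2, if_false] at h3
    simp only [h', R.faceOf_next]
    linarith
  have hvert : ∀ e e' : G.Dart, e.fst ∉ A → e.fst = e'.fst → h' e = h' e' := by
    intro e e' he hee'
    obtain ⟨n, hn⟩ := (R.sameCycle_of_fst_eq e e' hee').exists_nat_pow_eq
    rw [← hn]
    have : ∀ n : ℕ, ((R.next ^ n) e).fst = e.fst ∧ h' ((R.next ^ n) e) = h' e := by
      intro n
      induction n with
      | zero => simp
      | succ n ih =>
        rw [pow_succ', Equiv.Perm.mul_apply, R.next_fst, hnext _ (by rw [ih.1]; exact he)]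
        exact ih
    exact (this n).2.symm
  have hnot : ∀ v, v ∈ A' → v ∉ A := fun v hv hv' => Set.disjoint_left.mp hAA' hv' hv
  have hwalk : ∀ u v : A', (G.induce A').Walk u v →
      ∀ e e' : G.Dart, e.fst = u → e'.fst = v → h' e = h' e' := by
    intro u v w
    induction w with
    | @nil u => intro e e' h1 h2; exact hvert _ _ (by rw [h1]; exact hnot _ u.2) (h1.trans h2.symm)
    | @cons u v w huv p ih =>
      intro e e' he he'
      let f : G.Dart := ⟨(u.1, v.1), huv⟩
      rw [hvert e f (by rw [he]; exact hnot _ u.2) he, ← hsym f (Or.inl (hnot _ u.2))]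
      exact ih _ _ rfl he'
  obtain ⟨w'⟩ := hA' ⟨_, hxA⟩ ⟨_, hyA⟩
  have := hwalk _ _ w' x y rfl rfl
  simp only [h', ind, hx, hy, hxy, if_true, if_false] at this
  linarith

/-- If the vertices of a face are covered by two disjoint connected sets `A` and `A'`, then the part
of the face in `A` induces a connected graph. -/
theorem preconnected_faceVertices_inter (hR : R.IsPlanar) (hG : G.Connected) {A A' : Set V}
    (hA : (G.induce A).Preconnected) (hA' : (G.induce A').Preconnected) (hAA' : Disjoint A A')
    (d₀ : G.Dart) (hcov : ∀ v ∈ R.faceVertices d₀, v ∉ A → v ∈ A') :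
    (((G.induce (R.faceVertices d₀)).induce {p | p.1 ∈ A})).Preconnected := by
  set σ := R.faceStep with hσ
  have hΓ : ∀ (e : G.Dart) (n : ℕ), σ.SameCycle d₀ e → ((σ ^ n) e).fst ∈ R.faceVertices d₀ :=
    fun e n he => ⟨_, Equiv.Perm.sameCycle_pow_right.mpr he, rfl⟩
  -- A stretch of the boundary walk that stays in `A` is a path in the induced graph.
  have harc : ∀ (e : G.Dart) (_ : σ.SameCycle d₀ e) (n : ℕ)
      (_ : ∀ i ≤ n, ((σ ^ i) e).fst ∈ A) (x y : {p : R.faceVertices d₀ | p.1 ∈ A}),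
      x.1.1 = e.fst → y.1.1 = ((σ ^ n) e).fst →
      ((G.induce (R.faceVertices d₀)).induce {p | p.1 ∈ A}).Reachable x y := by
    intro e he n
    induction n with
    | zero =>
      intro _ x y hx hy
      have : x = y := Subtype.ext (Subtype.ext (hx.trans hy.symm))
      rw [this]
    | succ n ih =>
      intro hA x y hx hy
      refine (ih (fun i hi => hA i (hi.trans (Nat.le_succ n))) x
        ⟨⟨((σ ^ n) e).fst, hΓ e n he⟩, hA n (Nat.le_succ n)⟩ hx rfl).trans (Adj.reachable ?_)
      change G.Adj ((σ ^ n) e).fst y.1.1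
      rw [hy, pow_succ', Equiv.Perm.mul_apply, hσ, R.faceStep_fst]
      exact ((R.faceStep ^ n) e).adj
  rintro ⟨⟨p, dp, hdp, rfl⟩, hpA⟩ ⟨⟨q, dq, hdq, rfl⟩, hqA⟩
  have hpA : dp.fst ∈ A := hpA
  have hqA : dq.fst ∈ A := hqA
  have hpq := hdp.symm.trans hdq
  have hex1 := hpq.exists_nat_pow_eq
  have hex2 := hpq.symm.exists_nat_pow_eq
  -- Minimal step counts, so that the walks from `dp` to `dq` and back are disjoint arcs of the
  -- face.
  set n := Nat.find hex1 with hn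
  set m := Nat.find hex2 with hm
  have hn1 : (σ ^ n) dp = dq := Nat.find_spec hex1
  have hm1 : (σ ^ m) dq = dp := Nat.find_spec hex2
  have hn2 : ∀ i < n, (σ ^ i) dp ≠ dq := fun i hi => Nat.find_min hex1 hi
  have hm2 : ∀ i < m, (σ ^ i) dq ≠ dp := fun i hi => Nat.find_min hex2 hi
  by_cases hdd : dp = dq
  · subst hdd; exact Reachable.refl _
  have hn0 : 0 < n := by
    rcases Nat.eq_zero_or_pos n with h | h
    · rw [h] at hn1; exact absurd hn1 hdd
    · exact h
  let α : Set G.Dart := {e | ∃ i < n, (σ ^ i) dp = e}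
  have hpα : dp ∈ α := ⟨0, hn0, rfl⟩
  have hqα : dq ∉ α := fun ⟨i, hi, h⟩ => hn2 i hi h
  have hpα' : σ.symm dp ∉ α := by
    rintro ⟨i, hi, h⟩
    -- The walk would close up after `i + 1 ≤ n` steps and so reach `dq` before step `n`.
    have h1 : (σ ^ (i + 1)) dp = dp := by
      rw [pow_succ', Equiv.Perm.mul_apply, h, Equiv.apply_symm_apply]
    apply hn2 (n - (i + 1)) (by omega)
    rw [← hn1]
    conv_rhs => rw [show n = n - (i + 1) + (i + 1) by omega, pow_add, Equiv.Perm.mul_apply, h1]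
  have hqα' : σ.symm dq ∈ α := by
    refine ⟨n - 1, by omega, ?_⟩
    rw [Equiv.eq_symm_apply, ← Equiv.Perm.mul_apply, ← pow_succ', ← hn1]
    congr 2
    omega
  have hα : ∀ e, σ e ≠ dp → σ e ≠ dq → (σ e ∈ α ↔ e ∈ α) := by
    intro e h1 h2
    constructor
    · rintro ⟨i, hi, h⟩
      rcases Nat.eq_zero_or_pos i with rfl | hi0
      · exact absurd h.symm h1
      · refine ⟨i - 1, by omega, ?_⟩
        apply σ.injective
        rw [← h, ← Equiv.Perm.mul_apply, ← pow_succ']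
        congr 2
        omega
    · rintro ⟨i, hi, rfl⟩
      have h3 : σ ((σ ^ i) dp) = (σ ^ (i + 1)) dp := by rw [pow_succ', Equiv.Perm.mul_apply]
      rw [h3] at h2 ⊢
      rcases Nat.lt_or_ge (i + 1) n with h4 | h4
      · exact ⟨i + 1, h4, rfl⟩
      · rw [show i + 1 = n by omega] at h2
        exact absurd hn1 h2
  have hβ : ∀ i < m, (σ ^ i) dq ∉ α := by
    intro i
    induction i with
    | zero => intro _; exact hqα
    | succ i ih =>
      intro hi
      have h1 := ih (by omega)
      have h2 := hm2 (i + 1) hi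
      by_cases h3 : (σ ^ (i + 1)) dq = dq
      · rw [h3]; exact hqα
      · rw [pow_succ', Equiv.Perm.mul_apply] at h2 h3 ⊢
        rwa [hα _ h2 h3]
  by_cases hall : ∀ i < n, ((σ ^ i) dp).fst ∈ A
  · refine harc dp hdp n (fun i hi => ?_) _ _ rfl (by rw [hn1])
    rcases hi.lt_or_eq with h | h
    · exact hall i h
    · rw [h, hn1]; exact hqA
  by_cases hall' : ∀ i < m, ((σ ^ i) dq).fst ∈ A
  · refine (harc dq hdq m (fun i hi => ?_) _ _ rfl (by rw [hm1])).symm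
    rcases hi.lt_or_eq with h | h
    · exact hall' i h
    · rw [h, hm1]; exact hpA
  push Not at hall hall'
  -- If both arcs leave `A`, each meets `A'`, and `A'` crosses `A`.
  obtain ⟨i, hi, hiA⟩ := hall
  obtain ⟨j, hj, hjA⟩ := hall'
  refine (R.not_cross hR hG hA hA' hAA' (α := α) hpA hqA hpα hpα' hqα hqα' hα
    (x := (σ ^ i) dp) (y := (σ ^ j) dq) ?_ ⟨i, hi, rfl⟩ (hβ j hj)
    (hcov _ (hΓ _ _ hdp) hiA) (hcov _ (hΓ _ _ hdq) hjA)).elim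
  refine Quotient.sound ?_
  exact Equiv.Perm.sameCycle_pow_left.mpr (Equiv.Perm.sameCycle_pow_right.mpr hpq)

end RotationSystem

end Planarity

/-! ### Positive semidefinite square roots -/

section SquareRoot

open Matrix

variable {W : Type*} [Fintype W] {B : Matrix W W ℝ}

theorem mulVec_dotProduct_comm (hB : B.PosSemidef) (x y : W → ℝ) :
    B *ᵥ x ⬝ᵥ y = B *ᵥ y ⬝ᵥ x := by
  have hT : Bᵀ = B := by
    have := hB.isHermitian
    rwa [IsHermitian, conjTranspose_eq_transpose_of_trivial] at this
  rw [dotProduct_comm, dotProduct_mulVec, ← mulVec_transpose, hT]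

theorem form_nonneg (hB : B.PosSemidef) (x : W → ℝ) : 0 ≤ B *ᵥ x ⬝ᵥ x := by
  have := hB.dotProduct_mulVec_nonneg x
  rwa [star_trivial, dotProduct_comm] at this

theorem dotProduct_self_nonneg' (x : W → ℝ) : 0 ≤ x ⬝ᵥ x :=
  Finset.sum_nonneg fun i _ => mul_self_nonneg (x i)

theorem form_sub_smul (hB : B.PosSemidef) (x y : W → ℝ) (s : ℝ) :
    B *ᵥ (x - s • y) ⬝ᵥ (x - s • y) =
      B *ᵥ x ⬝ᵥ x - 2 * s * (B *ᵥ x ⬝ᵥ y) + s ^ 2 * (B *ᵥ y ⬝ᵥ y) := by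
  simp only [mulVec_sub, mulVec_smul, sub_dotProduct, dotProduct_sub, smul_dotProduct,
    dotProduct_smul, smul_eq_mul]
  rw [mulVec_dotProduct_comm hB y x]
  ring

theorem dotProduct_sub_smul (x y : W → ℝ) (s : ℝ) :
    (x - s • y) ⬝ᵥ (x - s • y) = x ⬝ᵥ x - 2 * s * (x ⬝ᵥ y) + s ^ 2 * (y ⬝ᵥ y) := by
  simp only [sub_dotProduct, dotProduct_sub, smul_dotProduct, dotProduct_smul, smul_eq_mul]
  rw [dotProduct_comm y x]
  ring

/-- Young's inequality for the dot product. -/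
theorem two_mul_dotProduct_le (x y : W → ℝ) (s : ℝ) :
    2 * s * (x ⬝ᵥ y) ≤ x ⬝ᵥ x + s ^ 2 * (y ⬝ᵥ y) := by
  have := dotProduct_self_nonneg' (x - s • y)
  rw [dotProduct_sub_smul] at this
  linarith

/-- The increment of the form of `B` between two consecutive layers is controlled by the energy of
the layers and of the connection between them. -/
theorem form_sub_form_le (hB : B.PosSemidef) (x y : W → ℝ) :
    B *ᵥ x ⬝ᵥ x - B *ᵥ y ⬝ᵥ y ≤
      (x - y) ⬝ᵥ (x - y) + (B *ᵥ x ⬝ᵥ B *ᵥ x + B *ᵥ y ⬝ᵥ B *ᵥ y) / 2 := by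
  -- By symmetry the left side is `(x - y) ⬝ᵥ (B x + B y)`; Young's inequality and the parallelogram
  -- law finish.
  have h1 := two_mul_dotProduct_le (x - y) (B *ᵥ x + B *ᵥ y) (1 / 2)
  have h2 := dotProduct_self_nonneg' (B *ᵥ x - B *ᵥ y)
  have h3 := mulVec_dotProduct_comm hB x y
  simp only [sub_dotProduct, dotProduct_sub, add_dotProduct, dotProduct_add] at h1 h2 ⊢
  rw [dotProduct_comm x (B *ᵥ x), dotProduct_comm x (B *ᵥ y), dotProduct_comm y (B *ᵥ x),
    dotProduct_comm y (B *ᵥ y)] at h1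
  rw [dotProduct_comm (B *ᵥ y) (B *ᵥ x)] at h1 h2
  linarith

/-- Cauchy–Schwarz for `B x` and `y`. The vector `y` may be `x` shifted by an element of the kernel
of `B`, which gives room for a Poincaré inequality. -/
theorem form_le_of_le {a b : ℝ} (hb : 0 ≤ b) (x y : W → ℝ)
    (hxy : B *ᵥ x ⬝ᵥ x = B *ᵥ x ⬝ᵥ y) (hy : y ⬝ᵥ y ≤ b ^ 2 * a)
    (hx : B *ᵥ x ⬝ᵥ B *ᵥ x ≤ a) : B *ᵥ x ⬝ᵥ x ≤ b * a := by
  rcases hb.eq_or_lt with rfl | hb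
  · have hy0 : y ⬝ᵥ y = 0 := le_antisymm (by simpa using hy) (dotProduct_self_nonneg' y)
    rw [dotProduct_self_eq_zero] at hy0
    rw [hxy, hy0]
    simp
  · have h1 := two_mul_dotProduct_le y (B *ᵥ x) b
    rw [hxy, dotProduct_comm]
    have h2 : b ^ 2 * (B *ᵥ x ⬝ᵥ B *ᵥ x) ≤ b ^ 2 * a := by gcongr
    have h3 : b * (y ⬝ᵥ B *ᵥ x) ≤ b * (b * a) := by nlinarith
    exact le_of_mul_le_mul_left h3 hb

variable {τ : ℝ}

/-- An upper bound for the form of `B` from one for the form of `B²`. -/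
theorem mul_form_le_of_sq
    (h : ∀ x : W → ℝ, τ ^ 2 * (B *ᵥ x ⬝ᵥ B *ᵥ x) ≤ x ⬝ᵥ x) (x : W → ℝ) :
    τ * (B *ᵥ x ⬝ᵥ x) ≤ x ⬝ᵥ x := by
  have h1 := two_mul_dotProduct_le x (B *ᵥ x) τ
  rw [dotProduct_comm x (B *ᵥ x)] at h1
  linarith [h x]

/-- One step of the iteration `x ↦ x - τ B x`. -/
theorem mul_dotProduct_le_form_sub (hB : B.PosSemidef) (hτ : 0 < τ)
    (h : ∀ x : W → ℝ, τ ^ 2 * (B *ᵥ x ⬝ᵥ B *ᵥ x) ≤ x ⬝ᵥ x) (x : W → ℝ) :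
    τ * (B *ᵥ x ⬝ᵥ B *ᵥ x) ≤
      B *ᵥ x ⬝ᵥ x - B *ᵥ (x - τ • B *ᵥ x) ⬝ᵥ (x - τ • B *ᵥ x) := by
  rw [form_sub_smul hB]
  -- The drop is `2τ |Bx|² - τ² ⟨B Bx, Bx⟩`, and the contraction property at `B x` bounds the last
  -- term by `τ |Bx|²`.
  have h1 := mul_form_le_of_sq h (B *ᵥ x)
  nlinarith

theorem mul_dotProduct_le_form (hB : B.PosSemidef) (hτ : 0 < τ)
    (h : ∀ x : W → ℝ, τ ^ 2 * (B *ᵥ x ⬝ᵥ B *ᵥ x) ≤ x ⬝ᵥ x) (x : W → ℝ) :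
    τ * (B *ᵥ x ⬝ᵥ B *ᵥ x) ≤ B *ᵥ x ⬝ᵥ x := by
  linarith [mul_dotProduct_le_form_sub hB hτ h x, form_nonneg hB (x - τ • B *ᵥ x)]

theorem dotProduct_step_le (hB : B.PosSemidef) (hτ : 0 < τ)
    (h : ∀ x : W → ℝ, τ ^ 2 * (B *ᵥ x ⬝ᵥ B *ᵥ x) ≤ x ⬝ᵥ x) (x : W → ℝ) :
    (x - τ • B *ᵥ x) ⬝ᵥ (x - τ • B *ᵥ x) ≤ x ⬝ᵥ x := by
  rw [dotProduct_sub_smul, dotProduct_comm x (B *ᵥ x)]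
  have h1 := mul_dotProduct_le_form hB hτ h x
  have h2 := form_nonneg hB x
  nlinarith

/-- A spectral gap of `B²` on the vectors of mean zero gives one of `B`. -/
theorem dotProduct_le_mul_form (hB : B.PosSemidef) (hB1 : B *ᵥ (fun _ => 1) = 0)
    {n : ℝ} (hn : 0 < n)
    (hgap : ∀ x : W → ℝ, ∑ p, x p = 0 → x ⬝ᵥ x ≤ n ^ 2 * (B *ᵥ x ⬝ᵥ B *ᵥ x))
    (x : W → ℝ) (hx : ∑ p, x p = 0) : x ⬝ᵥ x ≤ n * (B *ᵥ x ⬝ᵥ x) := by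
  classical
  -- Adding the all-ones matrix removes the constants from the kernel, so `B ξ = x` can be solved
  -- for `x` of mean zero.
  let J : Matrix W W ℝ := Matrix.of fun _ _ => 1
  have hJ : ∀ y : W → ℝ, J *ᵥ y = fun _ => ∑ p, y p := fun y => by
    ext p; simp [J, mulVec, dotProduct]
  have hinj : Function.Injective (B + J).mulVec := by
    refine (injective_iff_map_eq_zero (B + J).mulVecLin).mpr fun y hy => ?_
    have hy : (B + J) *ᵥ y = 0 := hy
    rw [add_mulVec, hJ] at hy
    have h1 : B *ᵥ y ⬝ᵥ y + (∑ p, y p) ^ 2 = 0 := by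
      have := congrArg (· ⬝ᵥ y) hy
      simp only [add_dotProduct, zero_dotProduct] at this
      rw [← this]
      simp [dotProduct, ← Finset.mul_sum, sq]
    have h2 := form_nonneg hB y
    have h3 : ∑ p, y p = 0 := by nlinarith [sq_nonneg (∑ p, y p)]
    have h4 : B *ᵥ y = 0 := by
      rw [h3] at hy
      simpa [funext_iff] using hy
    have h5 := hgap y h3
    rw [h4] at h5
    simp only [zero_dotProduct, mul_zero] at h5
    exact dotProduct_self_eq_zero.mp (le_antisymm h5 (dotProduct_self_nonneg' y))
  obtain ⟨ξ, hξ⟩ := mulVec_surjective_iff_isUnit.mpr (mulVec_injective_iff_isUnit.mp hinj) x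
  rcases isEmpty_or_nonempty W with hW | hW
  · simp [dotProduct]
  have hξ0 : ∑ p, ξ p = 0 := by
    have h1 := congrArg (· ⬝ᵥ (fun _ : W => (1 : ℝ))) hξ
    simp only [add_mulVec, add_dotProduct, hJ] at h1
    rw [mulVec_dotProduct_comm hB, hB1] at h1
    simp only [dotProduct, mul_one, hx, Pi.zero_apply, zero_mul, Finset.sum_const_zero, zero_add,
      Finset.sum_const, Finset.card_univ, nsmul_eq_mul] at h1
    rcases mul_eq_zero.mp h1 with h | h
    · exact absurd h (by positivity)
    · exact h
  have hBξ : B *ᵥ ξ = x := by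
    rw [← hξ, add_mulVec, hJ, hξ0]
    ext; simp
  have h1 := hgap ξ hξ0
  have h2 : B *ᵥ ξ ⬝ᵥ ξ ≤ n * (B *ᵥ ξ ⬝ᵥ B *ᵥ ξ) := form_le_of_le hn.le ξ ξ rfl h1 le_rfl
  -- Since `⟨B x, ξ⟩ = |x|²` and `⟨x, ξ⟩ ≤ n |x|²`, positivity at `x - ξ / n` gives `|x|² / n ≤ ⟨B
  -- x, x⟩`.
  have h3 := form_nonneg hB (x - (1 / n) • ξ)
  rw [form_sub_smul hB, mulVec_dotProduct_comm hB x ξ] at h3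
  rw [hBξ] at h2 h3
  have h4 : (1 / n) ^ 2 * (x ⬝ᵥ ξ) ≤ (1 / n) ^ 2 * (n * (x ⬝ᵥ x)) := by gcongr
  have h5 : (1 / n) ^ 2 * (n * (x ⬝ᵥ x)) = (1 / n) * (x ⬝ᵥ x) := by field_simp
  have h6 : (1 / n) * (x ⬝ᵥ x) ≤ B *ᵥ x ⬝ᵥ x := by linarith
  calc x ⬝ᵥ x = n * ((1 / n) * (x ⬝ᵥ x)) := by field_simp
    _ ≤ _ := by gcongr

end SquareRoot

/-! ### Dirichlet energy -/

section Energy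

open Matrix
open scoped Classical

variable {V : Type*} [Fintype V]

/-- The Dirichlet energy `∑ (u p - u q)²`, the sum being over the edges `{p, q}` of the graph. -/
noncomputable def energy (G : SimpleGraph V) (u : V → ℝ) : ℝ :=
  (∑ p, ∑ q, if G.Adj p q then (u p - u q) ^ 2 else 0) / 2

theorem energy_nonneg (G : SimpleGraph V) (u : V → ℝ) : 0 ≤ energy G u := by
  unfold energy
  positivity

variable [DecidableEq V]

theorem lapMatrix_form (G : SimpleGraph V) [DecidableRel G.Adj] (u : V → ℝ) :
    G.lapMatrix ℝ *ᵥ u ⬝ᵥ u = energy G u := by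
  rw [dotProduct_comm, ← toLinearMap₂'_apply', lapMatrix_toLinearMap₂', energy]
  congr!

theorem posSemidef_cfc_sqrt (A : Matrix V V ℝ) : (cfc Real.sqrt A).PosSemidef := by
  open scoped MatrixOrder in
  rw [← nonneg_iff_posSemidef]
  exact cfc_nonneg fun x _ => Real.sqrt_nonneg x

theorem cfc_sqrt_mul_self {A : Matrix V V ℝ} (hA : A.PosSemidef) :
    cfc Real.sqrt A * cfc Real.sqrt A = A := by
  rw [← cfc_mul Real.sqrt Real.sqrt A (by fun_prop) (by fun_prop)]
  conv_rhs => rw [← cfc_id ℝ A hA.isHermitian]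
  refine cfc_congr fun x hx => ?_
  simp only [id]
  refine Real.mul_self_sqrt ?_
  rw [hA.isHermitian.spectrum_real_eq_range_eigenvalues] at hx
  obtain ⟨i, rfl⟩ := hx
  exact hA.eigenvalues_nonneg i

/-- Together with positivity, this identity is all that the estimates below use about the square
root. -/
theorem sqrt_lapMatrix_dotProduct_self (G : SimpleGraph V) [DecidableRel G.Adj] (u : V → ℝ) :
    cfc Real.sqrt (G.lapMatrix ℝ) *ᵥ u ⬝ᵥ cfc Real.sqrt (G.lapMatrix ℝ) *ᵥ u = energy G u := by
  rw [← lapMatrix_form, mulVec_dotProduct_comm (posSemidef_cfc_sqrt _), mulVec_mulVec,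
    cfc_sqrt_mul_self (posSemidef_lapMatrix ℝ G)]

theorem sqrt_lapMatrix_mulVec_const (G : SimpleGraph V) [DecidableRel G.Adj] (a : ℝ) :
    cfc Real.sqrt (G.lapMatrix ℝ) *ᵥ (fun _ => a) = 0 := by
  rw [← dotProduct_self_eq_zero, sqrt_lapMatrix_dotProduct_self]
  simp [energy]

end Energy

/-! ### The Schur complement as a minimal energy -/

section Schur

open Matrix
open scoped Classical

variable {V : Type*} [Fintype V]

/-- The function that is `φ` on `Γ` and `y` on the complement. -/
noncomputable def glue {Γ : Set V} (φ : {p // p ∈ Γ} → ℝ) (y : {p // p ∉ Γ} → ℝ) (p : V) : ℝ :=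
  if h : p ∈ Γ then φ ⟨p, h⟩ else y ⟨p, h⟩

theorem sum_glue {Γ : Set V} (φ : {p // p ∈ Γ} → ℝ) (y : {p // p ∉ Γ} → ℝ) (f : V → ℝ → ℝ) :
    ∑ p, f p (glue φ y p) = ∑ p : {p // p ∈ Γ}, f p (φ p) + ∑ p : {p // p ∉ Γ}, f p (y p) := by
  rw [← Fintype.sum_subtype_add_sum_subtype (· ∈ Γ)]
  congr 1
  · exact Finset.sum_congr rfl fun p _ => by simp [glue, p.2]
  · exact Finset.sum_congr rfl fun p _ => by simp [glue, p.2]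

theorem mulVec_glue_dotProduct {Γ : Set V} (A : Matrix V V ℝ) (φ : {p // p ∈ Γ} → ℝ)
    (y : {p // p ∉ Γ} → ℝ) :
    A *ᵥ glue φ y ⬝ᵥ glue φ y =
      (A.toBlock (· ∈ Γ) (· ∈ Γ) *ᵥ φ ⬝ᵥ φ + A.toBlock (· ∈ Γ) (· ∉ Γ) *ᵥ y ⬝ᵥ φ) +
      (A.toBlock (· ∉ Γ) (· ∈ Γ) *ᵥ φ ⬝ᵥ y + A.toBlock (· ∉ Γ) (· ∉ Γ) *ᵥ y ⬝ᵥ y) := by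
  rw [← add_dotProduct, ← add_dotProduct]
  refine (sum_glue φ y fun p t => (A *ᵥ glue φ y) p * t).trans ?_
  have h : ∀ p, (A *ᵥ glue φ y) p =
      ∑ q : {p // p ∈ Γ}, A p q * φ q + ∑ q : {p // p ∉ Γ}, A p q * y q := fun p =>
    sum_glue φ y fun q t => A p q * t
  simp only [h]
  rfl

theorem posDef_interior_lapMatrix {G : SimpleGraph V} (hG : G.Connected) {Γ : Set V}
    (hΓ : Γ.Nonempty) : ((G.lapMatrix ℝ).toBlock (· ∉ Γ) (· ∉ Γ)).PosDef := by
  refine PosDef.of_dotProduct_mulVec_pos ?_ fun y hy => ?_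
  · have := G.isHermitian_lapMatrix (R := ℝ)
    exact this.submatrix _
  · rw [star_trivial, dotProduct_comm]
    have h1 := mulVec_glue_dotProduct (Γ := Γ) (G.lapMatrix ℝ) 0 y
    rw [lapMatrix_form] at h1
    simp only [mulVec_zero, dotProduct_zero, zero_dotProduct, zero_add] at h1
    rw [← h1]
    refine lt_of_le_of_ne (energy_nonneg _ _) fun h0 => hy ?_
    -- Zero energy on a connected graph forces a constant, which is zero because the function
    -- vanishes on `Γ`.
    rw [← lapMatrix_form, dotProduct_comm, ← toLinearMap₂'_apply', eq_comm,
      lapMatrix_toLinearMap₂'_apply'_eq_zero_iff_forall_reachable] at h0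
    obtain ⟨a, ha⟩ := hΓ
    funext p
    have := h0 p a (hG.preconnected _ _)
    simpa [glue, p.2, ha] using this

/-- Completing the square in the interior values; `z` is the harmonic extension of `φ`. -/
theorem energy_glue {G : SimpleGraph V} (hG : G.Connected) {Γ : Set V} (hΓ : Γ.Nonempty)
    (φ : {p // p ∈ Γ} → ℝ) :
    ∃ z : {p // p ∉ Γ} → ℝ, ∀ y, energy G (glue φ y) = quadForm (schurComplement G Γ) φ +
      (G.lapMatrix ℝ).toBlock (· ∉ Γ) (· ∉ Γ) *ᵥ (y - z) ⬝ᵥ (y - z) := by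
  set A := (G.lapMatrix ℝ).toBlock (· ∈ Γ) (· ∈ Γ) with hA
  set B := (G.lapMatrix ℝ).toBlock (· ∈ Γ) (· ∉ Γ) with hB
  set C := (G.lapMatrix ℝ).toBlock (· ∉ Γ) (· ∈ Γ) with hC
  set D := (G.lapMatrix ℝ).toBlock (· ∉ Γ) (· ∉ Γ) with hD
  have hpos : D.PosDef := posDef_interior_lapMatrix hG hΓ
  have hunit : IsUnit D.det := (isUnit_iff_isUnit_det D).mp hpos.isUnit
  have hBC : Bᵀ = C := by
    have h1 := G.isSymm_lapMatrix (R := ℝ)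
    rw [hB, hC]
    ext p q
    exact h1.apply _ _
  refine ⟨-(D⁻¹ *ᵥ (C *ᵥ φ)), fun y => ?_⟩
  have hS : quadForm (schurComplement G Γ) φ = A *ᵥ φ ⬝ᵥ φ - B *ᵥ (D⁻¹ *ᵥ (C *ᵥ φ)) ⬝ᵥ φ := by
    have : schurComplement G Γ = A - B * D⁻¹ * C := rfl
    unfold quadForm
    rw [this, sub_mulVec, sub_dotProduct, ← mulVec_mulVec, ← mulVec_mulVec]
  have hBx : ∀ x, B *ᵥ x ⬝ᵥ φ = C *ᵥ φ ⬝ᵥ x := fun x => by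
    rw [← hBC, mulVec_transpose, ← dotProduct_mulVec, dotProduct_comm]
  rw [← lapMatrix_form, mulVec_glue_dotProduct, hS, hBx, hBx, sub_neg_eq_add]
  set w := D⁻¹ *ᵥ (C *ᵥ φ) with hw
  have hDw : D *ᵥ w = C *ᵥ φ := by
    rw [hw, mulVec_mulVec, mul_nonsing_inv _ hunit, one_mulVec]
  have hcomm := mulVec_dotProduct_comm hpos.posSemidef y w
  rw [hDw] at hcomm
  simp only [mulVec_add, add_dotProduct, dotProduct_add, hDw, hcomm]
  ring

theorem quadForm_schurComplement_le {G : SimpleGraph V} (hG : G.Connected) {Γ : Set V}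
    (hΓ : Γ.Nonempty) (u : V → ℝ) :
    quadForm (schurComplement G Γ) (fun p => u p) ≤ energy G u := by
  obtain ⟨z, hz⟩ := energy_glue hG hΓ (fun p => u p)
  have h1 := hz fun p => u p
  have h2 : glue (Γ := Γ) (fun p => u p) (fun p => u p) = u := by
    funext p
    simp [glue]
  rw [h2] at h1
  rw [h1]
  linarith [form_nonneg (posDef_interior_lapMatrix hG hΓ).posSemidef ((fun p : {p // p ∉ Γ} => u p) - z)]

theorem exists_energy_eq_quadForm {G : SimpleGraph V} (hG : G.Connected) {Γ : Set V}
    (hΓ : Γ.Nonempty) (φ : Γ → ℝ) :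
    ∃ u : V → ℝ, (∀ p : Γ, u p = φ p) ∧ energy G u = quadForm (schurComplement G Γ) φ := by
  obtain ⟨z, hz⟩ := energy_glue hG hΓ φ
  refine ⟨glue φ z, fun p => by simp [glue], ?_⟩
  rw [hz z]
  simp

end Schur

/-! ### Energy along paths -/

section Paths

open scoped Classical

variable {V : Type*} [Fintype V]

/-- The energy of the edges inside `S`. -/
noncomputable def localEnergy (G : SimpleGraph V) (S : Set V) (u : V → ℝ) : ℝ :=
  (∑ p, ∑ q, if G.Adj p q ∧ p ∈ S ∧ q ∈ S then (u p - u q) ^ 2 else 0) / 2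

theorem localEnergy_nonneg (G : SimpleGraph V) (S : Set V) (u : V → ℝ) :
    0 ≤ localEnergy G S u := by
  unfold localEnergy
  positivity

/-- Bounded overlap: an edge inside `S i` has its first end in `S i`, so it is counted at most `c`
times. -/
theorem sum_localEnergy_le (G : SimpleGraph V) {ι : Type*} (s : Finset ι) (S : ι → Set V) (c : ℕ)
    (hc : ∀ p, (s.filter fun i => p ∈ S i).card ≤ c) (u : V → ℝ) :
    ∑ i ∈ s, localEnergy G (S i) u ≤ c * energy G u := by
  unfold localEnergy energy
  rw [← Finset.sum_div, mul_div_assoc']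
  gcongr
  rw [Finset.sum_comm, Finset.mul_sum]
  refine Finset.sum_le_sum fun p _ => ?_
  rw [Finset.sum_comm, Finset.mul_sum]
  refine Finset.sum_le_sum fun q _ => ?_
  by_cases hpq : G.Adj p q
  · simp only [hpq, true_and, if_true]
    calc ∑ i ∈ s, (if p ∈ S i ∧ q ∈ S i then (u p - u q) ^ 2 else 0)
        ≤ ∑ i ∈ s, if p ∈ S i then (u p - u q) ^ 2 else 0 := by
          refine Finset.sum_le_sum fun i _ => ?_
          by_cases h : p ∈ S i
          · simp only [h, true_and, if_true]
            split_ifs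
            · exact le_rfl
            · positivity
          · simp [h]
      _ = (s.filter fun i => p ∈ S i).card * (u p - u q) ^ 2 := by
          rw [← Finset.sum_filter, Finset.sum_const, nsmul_eq_mul]
      _ ≤ c * (u p - u q) ^ 2 := by
          gcongr
          exact_mod_cast hc p
  · simp [hpq]

theorem energy_eq_sum_darts (G : SimpleGraph V) (u : V → ℝ) :
    ∑ d : G.Dart, (u d.fst - u d.snd) ^ 2 = 2 * energy G u := by
  unfold energy
  rw [mul_div_cancel₀ _ two_ne_zero, ← Finset.sum_product', ← Finset.sum_filter]
  refine Finset.sum_bij' (fun d _ => d.toProd)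
    (fun x hx => ⟨x, (Finset.mem_filter.mp hx).2⟩) ?_ ?_ ?_ ?_ ?_ <;> simp

theorem localEnergy_eq (G : SimpleGraph V) (S : Set V) (u : V → ℝ) :
    localEnergy G S u = energy (G.induce S) (fun p => u p) := by
  unfold localEnergy energy
  congr 1
  have h : ∀ f : V → ℝ, (∀ p ∉ S, f p = 0) → ∑ p, f p = ∑ p : S, f p := by
    intro f hf
    rw [← Fintype.sum_subtype_add_sum_subtype (· ∈ S)]
    rw [Finset.sum_eq_zero (s := (Finset.univ : Finset {x // x ∉ S})) fun p _ => hf p p.2, add_zero]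
  rw [h _ fun p hp => by simp [hp]]
  refine Finset.sum_congr rfl fun p _ => ?_
  rw [h _ fun q hq => by simp [hq]]
  refine Finset.sum_congr rfl fun q _ => ?_
  simp

/-- Cauchy–Schwarz along the walk. -/
theorem sq_sub_le_length_mul_sum {V : Type*} {G : SimpleGraph V} (u : V → ℝ) {p q : V} (w : G.Walk p q) :
    (u p - u q) ^ 2 ≤ w.length * (w.darts.map fun d => (u d.fst - u d.snd) ^ 2).sum := by
  induction w with
  | nil => simp
  | @cons a b c hab w ih =>
    simp only [Walk.length_cons, Walk.darts_cons, List.map_cons, List.sum_cons, Nat.cast_add,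
      Nat.cast_one]
    set S := (w.darts.map fun d => (u d.fst - u d.snd) ^ 2).sum
    set n : ℝ := (w.length : ℝ)
    have hn : 0 ≤ n := Nat.cast_nonneg _
    have hS : 0 ≤ S := List.sum_nonneg fun x hx => by
      obtain ⟨d, -, rfl⟩ := List.mem_map.mp hx
      positivity
    set x := u a - u b
    set y := u b - u c
    have hxy : u a - u c = x + y := by ring
    rw [hxy]
    rcases hn.eq_or_lt with h0 | h0
    · rw [← h0] at ih ⊢
      have : y = 0 := by nlinarith [sq_nonneg y]
      rw [this]
      nlinarith
    · have h1 : 2 * x * y ≤ n * x ^ 2 + S := by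
        have h2 : n * (2 * x * y) ≤ n * (n * x ^ 2 + S) := by
          nlinarith [sq_nonneg (n * x - y)]
        exact le_of_mul_le_mul_left h2 h0
      nlinarith

/-- In a connected graph the difference of two values is controlled by the energy. -/
theorem sq_sub_le_card_mul_energy {G : SimpleGraph V} (hG : G.Preconnected) (u : V → ℝ) (p q : V) :
    (u p - u q) ^ 2 ≤ Fintype.card V * energy G u := by
  obtain ⟨w, hw⟩ := (hG p q).exists_isPath
  refine (sq_sub_le_length_mul_sum u w).trans ?_
  have hlen : (w.length : ℝ) ≤ Fintype.card V := by exact_mod_cast hw.length_lt.le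
  have hnd : w.darts.Nodup := (hw.isTrail.edges_nodup).of_map
  have hsum : (w.darts.map fun d => (u d.fst - u d.snd) ^ 2).sum ≤ energy G u := by
    rw [← List.sum_toFinset _ hnd]
    set s := w.darts.toFinset
    -- A path uses each edge once, so its darts and their reversals are disjoint; this cancels the
    -- factor two in the sum over darts.
    have hdisj : Disjoint s (s.image Dart.symm) := by
      rw [Finset.disjoint_left]
      intro d hd hd'
      obtain ⟨e, he, hed⟩ := Finset.mem_image.mp hd'
      have h1 : e = d := List.inj_on_of_nodup_map hw.isTrail.edges_nodup
        (List.mem_toFinset.mp he) (List.mem_toFinset.mp hd) (by rw [← hed, Dart.edge_symm])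
      rw [h1] at hed
      exact d.symm_ne hed
    have h1 : ∑ d ∈ s.image Dart.symm, (u d.fst - u d.snd) ^ 2 =
        ∑ d ∈ s, (u d.fst - u d.snd) ^ 2 := by
      rw [Finset.sum_image fun a _ b _ h => (Dart.symm_involutive (G := G)).injective h]
      refine Finset.sum_congr rfl fun d _ => ?_
      simp only [Dart.symm_toProd, Prod.fst_swap, Prod.snd_swap]
      ring
    have h2 : ∑ d ∈ s ∪ s.image Dart.symm, (u d.fst - u d.snd) ^ 2 ≤
        ∑ d : G.Dart, (u d.fst - u d.snd) ^ 2 :=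
      Finset.sum_le_sum_of_subset_of_nonneg (Finset.subset_univ _) fun d _ _ => sq_nonneg _
    rw [Finset.sum_union hdisj, h1, energy_eq_sum_darts] at h2
    linarith
  exact (mul_le_mul_of_nonneg_left hsum (Nat.cast_nonneg _)).trans
    (mul_le_mul_of_nonneg_right hlen (energy_nonneg G u))

theorem sq_sub_le_mul_localEnergy {G : SimpleGraph V} {S : Set V} {n : ℕ}
    (hS : (G.induce S).Preconnected) (hn : S.ncard ≤ n) (u : V → ℝ) {p q : V} (hp : p ∈ S)
    (hq : q ∈ S) : (u p - u q) ^ 2 ≤ n * localEnergy G S u := by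
  have h1 := sq_sub_le_card_mul_energy hS (fun p => u p) ⟨p, hp⟩ ⟨q, hq⟩
  rw [localEnergy_eq]
  refine h1.trans ?_
  have := energy_nonneg (G.induce S) (fun p => u p)
  gcongr
  rwa [← Nat.card_eq_fintype_card, Nat.card_coe_set_eq]

end Paths

/-! ### Rows and columns -/

section Labelling

open scoped Classical

/-- Two columns are equal or consecutive. -/
def Near {k : ℕ} [NeZero k] (i i' : Fin k) : Prop := i' = i ∨ i' = i + 1 ∨ i = i' + 1

theorem Near.symm {k : ℕ} [NeZero k] {i i' : Fin k} (h : Near i i') : Near i' i := by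
  rcases h with h | h | h
  · exact Or.inl h.symm
  · exact Or.inr (Or.inr h)
  · exact Or.inr (Or.inl h)

theorem cycleGraph_adj_iff {k : ℕ} [NeZero k] (hk : 2 ≤ k) {i i' : Fin k} :
    (cycleGraph k).Adj i i' ↔ i' = i + 1 ∨ i = i' + 1 := by
  obtain ⟨n, rfl⟩ := Nat.exists_eq_add_of_le' hk
  rw [cycleGraph_adj, sub_eq_iff_eq_add', sub_eq_iff_eq_add', or_comm, add_comm i, add_comm i']

/-- The vertices in column `i` and row `j`. -/
def cell {V : Type*} {k : ℕ} (col : V → Fin k) (row : V → ℕ) (i : Fin k) (j : ℕ) : Set V :=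
  {p | col p = i ∧ row p = j}

/-- An aggregation, described by the column and the row of each vertex, where the rows less than `ℓ`
are those of the aggregates and the remaining vertices are assigned a row `≥ ℓ`. -/
structure IsLabelling {V : Type*} (G : SimpleGraph V) (Γ : Set V) (k ℓ M : ℕ) [NeZero k]
    (col : V → Fin k) (row : V → ℕ) : Prop where
  near : ∀ {p q}, G.Adj p q → row p < ℓ → row q < ℓ → Near (col p) (col q)
  row_le : ∀ {p q}, G.Adj p q → row p < ℓ → row q < ℓ → row q ≤ row p + 1
  last_row : ∀ {p q}, G.Adj p q → row p < ℓ → ℓ ≤ row q → row p + 1 = ℓ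
  connected : ∀ i j, j < ℓ → (G.induce (cell col row i j)).Connected
  ncard_le : ∀ i j, j < ℓ → (cell col row i j).ncard ≤ M
  boundary_row : ∀ p ∈ Γ, row p = 0
  boundary_col : ∀ i, ∃ p ∈ Γ, col p = i
  horizontal : ∀ i j, j < ℓ → ∃ p ∈ cell col row i j, ∃ q ∈ cell col row (i + 1) j, G.Adj p q
  vertical : ∀ i j, j + 1 < ℓ → ∃ p ∈ cell col row i j, ∃ q ∈ cell col row i (j + 1), G.Adj p q

/-- Row and column functions turn sums over aggregates into sums over fibers. -/
theorem exists_isLabelling {V : Type*} {G : SimpleGraph V} {Γ : Set V} {k ℓ M : ℕ} [NeZero k]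
    (hk : 2 ≤ k) (hℓ : 0 < ℓ) {H : SimpleGraph (Fin k × Fin ℓ)} (hH₁ : annulus k ℓ ≤ H)
    (hH₂ : H ≤ annulusStar k ℓ) (hagg : IsAggregation M G Γ H) :
    ∃ (col : V → Fin k) (row : V → ℕ), IsLabelling G Γ k ℓ M col row := by
  obtain ⟨aStar, a, h⟩ := hagg
  -- Vertices of `aStar` receive row `ℓ`; their column `0` is a dummy value.
  let lab : V → Fin k × ℕ := fun p =>
    if hp : ∃ x, p ∈ a x then (hp.choose.1, (hp.choose.2 : ℕ)) else (0, ℓ)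
  have hlab : ∀ p x, p ∈ a x → lab p = (x.1, (x.2 : ℕ)) := by
    intro p x hx
    have hp : ∃ x, p ∈ a x := ⟨x, hx⟩
    have heq : hp.choose = x := by
      by_contra hne
      exact Set.disjoint_left.mp (h.disjoint _ _ hne) hp.choose_spec hx
    simp only [lab, dif_pos hp, heq]
  have hlt : ∀ p, (lab p).2 < ℓ → ∃ x, p ∈ a x := by
    intro p hp
    by_contra hne
    simp only [lab, dif_neg hne, lt_irrefl] at hp
  have hcell : ∀ i j (hj : j < ℓ),
      cell (fun p => (lab p).1) (fun p => (lab p).2) i j = a (i, ⟨j, hj⟩) := by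
    intro i j hj
    ext p
    constructor
    · rintro ⟨h1, h2⟩
      obtain ⟨x, hx⟩ := hlt p (by simp only at h2; rw [h2]; exact hj)
      have := hlab p x hx
      simp only [this] at h1 h2
      have hx' : x = (i, ⟨j, hj⟩) := Prod.ext h1 (Fin.ext h2)
      rwa [hx'] at hx
    · intro hp
      have := hlab _ _ hp
      exact ⟨by simp [this], by simp [this]⟩
  have hadj : ∀ p q x y, G.Adj p q → p ∈ a x → q ∈ a y → x ≠ y → (annulusStar k ℓ).Adj x y := by
    intro p q x y hpq hp hq hxy
    apply hH₂
    rw [← h.aggregationGraph_eq]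
    exact ⟨hxy, p, hp, q, hq, hpq⟩
  have hnear : ∀ x y, (annulusStar k ℓ).Adj x y →
      Near x.1 y.1 ∧ (y.2 : ℕ) ≤ x.2 + 1 := by
    intro x y hxy
    rcases hxy with hxy | hxy
    · rw [annulus, boxProd_adj, cycleGraph_adj_iff hk, pathGraph_adj] at hxy
      rcases hxy with ⟨h1, h2⟩ | ⟨h1, h2⟩
      · exact ⟨Or.inr h1, by rw [h2]; omega⟩
      · exact ⟨Or.inl h2.symm, by omega⟩
    · rw [fromRel_adj] at hxy
      rcases hxy.2 with ⟨h1, h2⟩ | ⟨h1, h2⟩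
      · exact ⟨Or.inr ((cycleGraph_adj_iff hk).mp h1), by omega⟩
      · exact ⟨Near.symm (Or.inr ((cycleGraph_adj_iff hk).mp h1)), by omega⟩
  have hedge : ∀ x y, (annulus k ℓ).Adj x y → ∃ p ∈ a x, ∃ q ∈ a y, G.Adj p q := by
    intro x y hxy
    have := hH₁ hxy
    rw [← h.aggregationGraph_eq] at this
    exact this.2
  refine ⟨fun p => (lab p).1, fun p => (lab p).2, ?_⟩
  constructor
  · intro p q hpq hp hq
    obtain ⟨x, hx⟩ := hlt p hp
    obtain ⟨y, hy⟩ := hlt q hq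
    simp only [hlab p x hx, hlab q y hy]
    by_cases hxy : x = y
    · rw [hxy]; exact Or.inl rfl
    · exact (hnear x y (hadj p q x y hpq hx hy hxy)).1
  · intro p q hpq hp hq
    obtain ⟨x, hx⟩ := hlt p hp
    obtain ⟨y, hy⟩ := hlt q hq
    simp only [hlab p x hx, hlab q y hy]
    by_cases hxy : x = y
    · rw [hxy]; omega
    · exact (hnear x y (hadj p q x y hpq hx hy hxy)).2
  · intro p q hpq hp hq
    obtain ⟨x, hx⟩ := hlt p hp
    have hq' : q ∈ aStar := by
      have h1 : q ∈ aStar ∪ ⋃ x, a x := by rw [h.union_eq]; trivial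
      rcases h1 with h1 | h1
      · exact h1
      · obtain ⟨y, hy⟩ := Set.mem_iUnion.mp h1
        simp only [hlab q y hy] at hq
        exact absurd y.2.2 (not_lt.mpr hq)
    rcases h.star_neighbors q hq' p hpq.symm with h1 | ⟨y, hy1, hy2⟩
    · exact absurd hx (Set.disjoint_left.mp (h.disjoint_star x) h1)
    · simp only [hlab p y hy2]
      exact hy1
  · intro i j hj
    rw [hcell i j hj]
    exact h.connected _
  · intro i j hj
    rw [hcell i j hj]
    exact h.ncard_le _
  · intro p hp
    obtain ⟨x, hx1, hx2⟩ := h.boundary_subset p hp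
    simp only [hlab p x hx2, hx1]
  · intro i
    obtain ⟨p, hp1, hp2⟩ := h.boundary_inter (i, ⟨0, hℓ⟩) rfl
    exact ⟨p, hp1, by simp only [hlab p _ hp2]⟩
  · intro i j hj
    rw [hcell i j hj, hcell (i + 1) j hj]
    refine hedge _ _ ?_
    rw [annulus, boxProd_adj]
    exact Or.inl ⟨(cycleGraph_adj_iff hk).mpr (Or.inl rfl), rfl⟩
  · intro i j hj
    rw [hcell i j (by omega), hcell i (j + 1) hj]
    refine hedge _ _ ?_
    rw [annulus, boxProd_adj]
    exact Or.inr ⟨pathGraph_adj.mpr (Or.inl rfl), rfl⟩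

end Labelling

/-! ### The lower bound -/

section LowerBound

open Matrix
open scoped Classical

/-- The energy of a function on the cycle of columns. -/
noncomputable def cycleEnergy {k : ℕ} [NeZero k] (f : Fin k → ℝ) : ℝ :=
  ∑ i, (f (i + 1) - f i) ^ 2

theorem cycleEnergy_nonneg {k : ℕ} [NeZero k] (f : Fin k → ℝ) : 0 ≤ cycleEnergy f :=
  Finset.sum_nonneg fun _ _ => sq_nonneg _

theorem sq_sub_le_mul_sum_range (f : ℕ → ℝ) (n : ℕ) :
    (f n - f 0) ^ 2 ≤ n * ∑ m ∈ Finset.range n, (f (m + 1) - f m) ^ 2 := by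
  rw [← Finset.sum_range_sub]
  simpa using sq_sum_le_card_mul_sum_sq (s := Finset.range n) (f := fun m => f (m + 1) - f m)

/-- Go from column `0` up to `i` without wrapping around; the path has at most `k` steps. -/
theorem sq_sub_zero_le_mul_cycleEnergy {k : ℕ} [NeZero k] (f : Fin k → ℝ) (i : Fin k) :
    (f i - f 0) ^ 2 ≤ k * cycleEnergy f := by
  have h1 := sq_sub_le_mul_sum_range (fun n => f (Fin.ofNat k n)) i
  have h2 : Fin.ofNat k i = i := by ext; simp
  have h3 : Fin.ofNat k 0 = 0 := rfl
  simp only [h2, h3] at h1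
  refine h1.trans ?_
  have h4 : ∑ m ∈ Finset.range i, (f (Fin.ofNat k (m + 1)) - f (Fin.ofNat k m)) ^ 2 ≤
      cycleEnergy f := by
    calc _ ≤ ∑ m ∈ Finset.range k, (f (Fin.ofNat k (m + 1)) - f (Fin.ofNat k m)) ^ 2 :=
          Finset.sum_le_sum_of_subset_of_nonneg
            (Finset.range_subset_range.mpr i.2.le) fun _ _ _ => sq_nonneg _
      _ = cycleEnergy f := by
          rw [Finset.sum_range, cycleEnergy]
          refine Finset.sum_congr rfl fun m _ => ?_
          have h5 : Fin.ofNat k m = m := by ext; simp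
          have h6 : Fin.ofNat k (m + 1) = m + 1 := by
            ext
            simp [Fin.val_add]
          rw [h5, h6]
  have h7 : ((i : ℕ) : ℝ) ≤ k := by exact_mod_cast i.2.le
  exact mul_le_mul h7 h4 (Finset.sum_nonneg fun _ _ => sq_nonneg _) (Nat.cast_nonneg _)

/-! ### Comparison of the energy with samples in the aggregates -/

namespace IsLabelling

set_option linter.unusedSectionVars false

variable {V : Type*} [Fintype V] {G : SimpleGraph V} {Γ : Set V} {k ℓ M : ℕ} [NeZero k]
  {col : V → Fin k} {row : V → ℕ}

theorem card_boundary_col_le (h : IsLabelling G Γ k ℓ M col row) (hℓ : 0 < ℓ) (i : Fin k) :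
    (Finset.univ.filter fun p : Γ => col p = i).card ≤ M := by
  refine le_trans ?_ (h.ncard_le i 0 hℓ)
  rw [Set.ncard_eq_toFinset_card']
  refine Finset.card_le_card_of_injOn (fun p => p.1) ?_ (Subtype.val_injective.injOn)
  intro p hp
  have hp : col p = i := by simpa using hp
  simpa using ⟨hp, h.boundary_row p p.2⟩

theorem sum_boundary_le (h : IsLabelling G Γ k ℓ M col row) (hℓ : 0 < ℓ) {f : Fin k → ℝ}
    (hf : ∀ i, 0 ≤ f i) : ∑ p : Γ, f (col p) ≤ M * ∑ i, f i := by
  rw [← Finset.sum_fiberwise (s := Finset.univ) (g := fun p : Γ => col p), Finset.mul_sum]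
  refine Finset.sum_le_sum fun i _ => ?_
  calc ∑ p ∈ Finset.univ.filter (fun p : Γ => col p = i), f (col p) =
      ∑ p ∈ Finset.univ.filter (fun p : Γ => col p = i), f i :=
        Finset.sum_congr rfl fun p hp => by rw [(Finset.mem_filter.mp hp).2]
    _ ≤ M * f i := by
        rw [Finset.sum_const, nsmul_eq_mul]
        exact mul_le_mul_of_nonneg_right (by exact_mod_cast h.card_boundary_col_le hℓ i) (hf i)

theorem one_le (h : IsLabelling G Γ k ℓ M col row) (hℓ : 0 < ℓ) : 1 ≤ M := by
  refine le_trans ?_ (h.ncard_le 0 0 hℓ)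
  obtain ⟨⟨p, hp⟩⟩ := (h.connected 0 0 hℓ).nonempty
  exact (Set.ncard_pos (Set.toFinite _)).mpr ⟨p, hp⟩

theorem near_boundary (h : IsLabelling G Γ k ℓ M col row) (hℓ : 0 < ℓ) {p q : Γ}
    (hpq : G.Adj p q) : Near (col p) (col q) :=
  h.near hpq (by rw [h.boundary_row p p.2]; exact hℓ) (by rw [h.boundary_row q q.2]; exact hℓ)

/-- Boundary edges join equal or consecutive columns, and each pair of columns carries at most `M *
M` pairs of boundary vertices. -/
theorem energy_boundary_comp_col_le (h : IsLabelling G Γ k ℓ M col row) (hℓ : 0 < ℓ)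
    (f : Fin k → ℝ) :
    energy (G.induce Γ) (fun p => f (col p)) ≤ M ^ 2 * cycleEnergy f := by
  let F : Fin k → Fin k → ℝ := fun i i' =>
    (if i' = i + 1 then (f i - f i') ^ 2 else 0) + if i = i' + 1 then (f i - f i') ^ 2 else 0
  have hF : ∀ i i', 0 ≤ F i i' := fun i i' => by positivity
  have h1 : ∀ p q : Γ, (if (G.induce Γ).Adj p q then (f (col p) - f (col q)) ^ 2 else 0) ≤
      F (col p) (col q) := by
    intro p q
    split_ifs with hpq
    · rcases h.near_boundary hℓ hpq with h2 | h2 | h2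
      · rw [h2]
        simpa using hF _ _
      · simp only [F, if_pos h2]
        refine le_add_of_nonneg_right ?_
        positivity
      · simp only [F, if_pos h2]
        refine le_add_of_nonneg_left ?_
        positivity
    · exact hF _ _
  have h2 : ∑ i, ∑ i', F i i' = 2 * cycleEnergy f := by
    simp only [F, Finset.sum_add_distrib]
    have h3 : ∑ i, ∑ i', (if i = i' + 1 then (f i - f i') ^ 2 else 0) = cycleEnergy f := by
      rw [Finset.sum_comm]
      simp [cycleEnergy]
    rw [h3]
    simp only [Finset.sum_ite_eq', Finset.mem_univ, if_true]
    have h4 : ∑ i, (f i - f (i + 1)) ^ 2 = cycleEnergy f :=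
      Finset.sum_congr rfl fun i _ => by ring
    rw [h4]
    ring
  have h3 : ∑ p : Γ, ∑ q : Γ,
      (if (G.induce Γ).Adj p q then (f (col p) - f (col q)) ^ 2 else 0) ≤
      M * (M * (2 * cycleEnergy f)) := by
    calc _ ≤ ∑ p : Γ, ∑ q : Γ, F (col p) (col q) :=
          Finset.sum_le_sum fun p _ => Finset.sum_le_sum fun q _ => h1 p q
      _ ≤ ∑ p : Γ, M * ∑ i', F (col p) i' :=
          Finset.sum_le_sum fun p _ => h.sum_boundary_le hℓ (hF _)
      _ = M * ∑ p : Γ, ∑ i', F (col p) i' := by rw [Finset.mul_sum]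
      _ ≤ M * (M * ∑ i, ∑ i', F i i') := by
          gcongr
          exact h.sum_boundary_le hℓ (f := fun i => ∑ i', F i i')
            fun i => Finset.sum_nonneg fun i' _ => hF i i'
      _ = _ := by rw [h2]
  simp only [energy]
  linarith

/-- Two adjacent cells form a connected set of at most `2 * M` vertices. -/
theorem sq_sub_le_of_adj_cells (h : IsLabelling G Γ k ℓ M col row) {i i' : Fin k} {j j' : ℕ}
    (hj : j < ℓ) (hj' : j' < ℓ)
    (he : ∃ p ∈ cell col row i j, ∃ q ∈ cell col row i' j', G.Adj p q) (u : V → ℝ) {p q : V}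
    (hp : p ∈ cell col row i j) (hq : q ∈ cell col row i' j') :
    (u p - u q) ^ 2 ≤
      2 * M * localEnergy G (cell col row i j ∪ cell col row i' j') u := by
  obtain ⟨a, ha, b, hb, hab⟩ := he
  have h1 := connected_induce_union (h.connected i j hj).preconnected
    (h.connected i' j' hj').preconnected ha hb hab
  have h2 : (cell col row i j ∪ cell col row i' j').ncard ≤ 2 * M :=
    (Set.ncard_union_le _ _).trans (by linarith [h.ncard_le i j hj, h.ncard_le i' j' hj'])
  have := sq_sub_le_mul_localEnergy h1.preconnected h2 u (Or.inl hp) (Or.inr hq)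
  simpa using this

theorem sum_horizontal_le (h : IsLabelling G Γ k ℓ M col row) (u : V → ℝ)
    {r : Fin k → ℕ → V} (hr : ∀ i j, j < ℓ → r i j ∈ cell col row i j) :
    ∑ j ∈ Finset.range ℓ, cycleEnergy (fun i => u (r i j)) ≤ 4 * M * energy G u := by
  unfold cycleEnergy
  rw [← Finset.sum_product']
  have h1 := sum_localEnergy_le G (Finset.range ℓ ×ˢ (Finset.univ : Finset (Fin k)))
    (fun x => cell col row (x.2 + 1) x.1 ∪ cell col row x.2 x.1) 2 (fun p => by
      refine (Finset.card_le_card (t := {(row p, col p - 1), (row p, col p)}) ?_).trans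
        Finset.card_le_two
      rintro ⟨j, i⟩ hx
      simp only [Finset.mem_filter] at hx
      rcases hx.2 with ⟨h1, h2⟩ | ⟨h1, h2⟩
      · simp [h1, h2]
      · simp [h1, h2]) u
  calc _ ≤ ∑ x ∈ Finset.range ℓ ×ˢ (Finset.univ : Finset (Fin k)), 2 * M *
        localEnergy G (cell col row (x.2 + 1) x.1 ∪ cell col row x.2 x.1) u := by
        refine Finset.sum_le_sum fun x hx => ?_
        have hx : x.1 < ℓ := by simpa using (Finset.mem_product.mp hx).1
        obtain ⟨p, hp, q, hq, hpq⟩ := h.horizontal x.2 x.1 hx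
        exact h.sq_sub_le_of_adj_cells hx hx ⟨q, hq, p, hp, hpq.symm⟩ u (hr _ _ hx) (hr _ _ hx)
    _ ≤ 2 * M * ((2 : ℕ) * energy G u) := by
        rw [← Finset.mul_sum]
        gcongr
    _ = _ := by push_cast; ring

theorem sum_vertical_le (h : IsLabelling G Γ k ℓ M col row) (u : V → ℝ)
    {r : Fin k → ℕ → V} (hr : ∀ i j, j < ℓ → r i j ∈ cell col row i j) :
    ∑ j ∈ Finset.range (ℓ - 1), ∑ i, (u (r i j) - u (r i (j + 1))) ^ 2 ≤
      4 * M * energy G u := by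
  rw [← Finset.sum_product']
  have h1 := sum_localEnergy_le G (Finset.range (ℓ - 1) ×ˢ (Finset.univ : Finset (Fin k)))
    (fun x => cell col row x.2 x.1 ∪ cell col row x.2 (x.1 + 1)) 2 (fun p => by
      -- In row `0` the truncated subtraction merely repeats the first candidate.
      refine (Finset.card_le_card (t := {(row p, col p), (row p - 1, col p)}) ?_).trans
        Finset.card_le_two
      rintro ⟨j, i⟩ hx
      simp only [Finset.mem_filter] at hx
      rcases hx.2 with ⟨h1, h2⟩ | ⟨h1, h2⟩
      · simp [h1, h2]
      · simp [h1, h2]) u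
  calc _ ≤ ∑ x ∈ Finset.range (ℓ - 1) ×ˢ (Finset.univ : Finset (Fin k)), 2 * M *
        localEnergy G (cell col row x.2 x.1 ∪ cell col row x.2 (x.1 + 1)) u := by
        refine Finset.sum_le_sum fun x hx => ?_
        have hx : x.1 < ℓ - 1 := by simpa using (Finset.mem_product.mp hx).1
        exact h.sq_sub_le_of_adj_cells (by omega) (by omega) (h.vertical x.2 x.1 (by omega)) u
          (hr _ _ (by omega)) (hr _ _ (by omega))
    _ ≤ 2 * M * ((2 : ℕ) * energy G u) := by
        rw [← Finset.mul_sum]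
        gcongr
    _ = _ := by push_cast; ring

theorem sum_boundary_sub_le (h : IsLabelling G Γ k ℓ M col row) (hℓ : 0 < ℓ) (u : V → ℝ)
    {r : Fin k → V} (hr : ∀ i, r i ∈ cell col row i 0) :
    ∑ p : Γ, (u p - u (r (col p))) ^ 2 ≤ M ^ 2 * energy G u := by
  have h1 := sum_localEnergy_le G (Finset.univ : Finset (Fin k))
    (fun i => cell col row i 0) 1 (fun p => by
      refine (Finset.card_le_card (t := {col p}) ?_).trans (Finset.card_singleton _).le
      intro i hx
      have hx := (Finset.mem_filter.mp hx).2
      simp [hx.1]) u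
  calc _ ≤ ∑ p : Γ, M * localEnergy G (cell col row (col p) 0) u := by
        refine Finset.sum_le_sum fun p _ => ?_
        exact sq_sub_le_mul_localEnergy (h.connected _ _ hℓ).preconnected (h.ncard_le _ _ hℓ) u
          ⟨rfl, h.boundary_row p p.2⟩ (hr _)
    _ = M * ∑ p : Γ, localEnergy G (cell col row (col p) 0) u := by rw [Finset.mul_sum]
    _ ≤ M * (M * ∑ i, localEnergy G (cell col row i 0) u) := by
        gcongr
        exact h.sum_boundary_le hℓ (f := fun i => localEnergy G (cell col row i 0) u)
          fun i => localEnergy_nonneg _ _ _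
    _ ≤ M * (M * ((1 : ℕ) * energy G u)) := by gcongr
    _ = _ := by push_cast; ring

theorem energy_boundary_le (u : V → ℝ) :
    energy (G.induce Γ) (fun p => u p) ≤ energy G u := by
  rw [← localEnergy_eq]
  unfold localEnergy energy
  gcongr with p _ q _
  split_ifs with h1 h2 h3
  · exact le_rfl
  · exact absurd h1.1 h2
  · positivity
  · exact le_rfl

/-- The trace inequality: the form of the square root of the boundary Laplacian is controlled by the
energy of any extension. -/
theorem sqrt_form_le_energy (h : IsLabelling G Γ k ℓ M col row) (hℓ : 0 < ℓ) {c : ℕ}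
    (hkc : k ≤ 2 * c * ℓ) (u : V → ℝ) :
    cfc Real.sqrt ((G.induce Γ).lapMatrix ℝ) *ᵥ (fun p => u p) ⬝ᵥ (fun p => u p) ≤
      (10 + 8 * c) * M ^ 3 * energy G u := by
  set B := cfc Real.sqrt ((G.induce Γ).lapMatrix ℝ) with hBdef
  have hB : B.PosSemidef := posSemidef_cfc_sqrt _
  have hBB : ∀ x, B *ᵥ x ⬝ᵥ B *ᵥ x = energy (G.induce Γ) x :=
    fun x => sqrt_lapMatrix_dotProduct_self _ x
  have hM : (1 : ℝ) ≤ M := by exact_mod_cast h.one_le hℓ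
  have hE := energy_nonneg G u
  obtain ⟨v₀, -⟩ := h.boundary_col 0
  have hex : ∀ i j, ∃ p, j < ℓ → p ∈ cell col row i j := by
    intro i j
    by_cases hj : j < ℓ
    · obtain ⟨⟨p, hp⟩⟩ := (h.connected i j hj).nonempty
      exact ⟨p, fun _ => hp⟩
    · exact ⟨v₀, fun hj' => absurd hj' hj⟩
  choose r hr using hex
  -- Layer `0` is the trace itself; layer `j + 1` holds the samples of row `j`, hence the shift in
  -- the sums below.
  let x : ℕ → Γ → ℝ := fun j => Nat.casesOn j (fun p => u p) fun j p => u (r (col p) j)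
  let e : ℕ → ℝ := fun j => cycleEnergy fun i => u (r i j)
  have he : ∀ j, 0 ≤ e j := fun j => cycleEnergy_nonneg _
  have hsum_e : ∑ j ∈ Finset.range ℓ, e j ≤ 4 * M * energy G u := h.sum_horizontal_le u hr
  have hx0 : energy (G.induce Γ) (x 0) ≤ energy G u := energy_boundary_le u
  have hxs : ∀ j, energy (G.induce Γ) (x (j + 1)) ≤ M ^ 2 * e j := fun j =>
    h.energy_boundary_comp_col_le hℓ fun i => u (r i j)
  -- The telescoping stops at the row of least horizontal energy, where `ℓ * e J` is at most the
  -- total.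
  obtain ⟨J, hJ, hJmin⟩ := Finset.exists_min_image (Finset.range ℓ) e ⟨0, by simpa using hℓ⟩
  have hJℓ : J < ℓ := by simpa using hJ
  have hend : B *ᵥ x (J + 1) ⬝ᵥ x (J + 1) ≤ k * (M ^ 2 * e J) := by
    -- Subtracting the sample in column `0` is free, as `B` kills constants; the Poincaré constant
    -- is `k`.
    refine form_le_of_le (Nat.cast_nonneg _) (x (J + 1))
      (x (J + 1) - fun _ => u (r 0 J)) ?_ ?_ ?_
    · rw [dotProduct_sub, mulVec_dotProduct_comm hB _ (fun _ => u (r 0 J)),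
        sqrt_lapMatrix_mulVec_const]
      simp
    · calc _ = ∑ p : Γ, (u (r (col p) J) - u (r 0 J)) ^ 2 :=
            Finset.sum_congr rfl fun p _ => (sq _).symm
        _ ≤ M * ∑ i, (u (r i J) - u (r 0 J)) ^ 2 :=
            h.sum_boundary_le hℓ (f := fun i => (u (r i J) - u (r 0 J)) ^ 2) fun i => sq_nonneg _
        _ ≤ M * ∑ i : Fin k, k * e J := by
            gcongr with i
            exact sq_sub_zero_le_mul_cycleEnergy (fun i => u (r i J)) i
        _ = (k ^ 2 * e J) * M := by
            rw [Finset.sum_const, Finset.card_univ, Fintype.card_fin, nsmul_eq_mul]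
            ring
        _ ≤ (k ^ 2 * e J) * M ^ 2 := by
            have := he J
            gcongr
            nlinarith
        _ = _ := by ring
    · rw [hBB]
      exact hxs J
  have hend' : k * (M ^ 2 * e J) ≤ 8 * c * M ^ 3 * energy G u := by
    have h1 : ℓ * e J ≤ 4 * M * energy G u := by
      refine le_trans ?_ hsum_e
      have := Finset.card_nsmul_le_sum (Finset.range ℓ) e (e J) hJmin
      simpa using this
    have h2 : (k : ℝ) ≤ 2 * c * ℓ := by exact_mod_cast hkc
    calc k * (M ^ 2 * e J) ≤ (2 * c * ℓ) * (M ^ 2 * e J) := by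
          have := he J
          gcongr
      _ = 2 * c * M ^ 2 * (ℓ * e J) := by ring
      _ ≤ 2 * c * M ^ 2 * (4 * M * energy G u) := by gcongr
      _ = _ := by ring
  have htel : B *ᵥ x 0 ⬝ᵥ x 0 - B *ᵥ x (J + 1) ⬝ᵥ x (J + 1) ≤
      ∑ j ∈ Finset.range (J + 1), ((x j - x (j + 1)) ⬝ᵥ (x j - x (j + 1)) +
        (energy (G.induce Γ) (x j) + energy (G.induce Γ) (x (j + 1))) / 2) := by
    refine (Finset.sum_range_sub' (fun j => B *ᵥ x j ⬝ᵥ x j) (J + 1)).ge.trans ?_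
    refine Finset.sum_le_sum fun j _ => ?_
    rw [← hBB, ← hBB]
    exact form_sub_form_le hB _ _
  have hdiff : ∑ j ∈ Finset.range (J + 1), (x j - x (j + 1)) ⬝ᵥ (x j - x (j + 1)) ≤
      5 * M ^ 2 * energy G u := by
    rw [Finset.sum_range_succ']
    have h1 : (x 0 - x (0 + 1)) ⬝ᵥ (x 0 - x (0 + 1)) ≤ M ^ 2 * energy G u := by
      refine le_trans (le_of_eq ?_) (h.sum_boundary_sub_le hℓ u fun i => hr i 0 hℓ)
      exact Finset.sum_congr rfl fun p _ => (sq _).symm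
    have h2 : ∑ j ∈ Finset.range J, (x (j + 1) - x (j + 1 + 1)) ⬝ᵥ (x (j + 1) - x (j + 1 + 1)) ≤
        M * (4 * M * energy G u) := by
      refine le_trans ?_ (mul_le_mul_of_nonneg_left (h.sum_vertical_le u hr) (Nat.cast_nonneg M))
      rw [Finset.mul_sum]
      refine le_trans ?_ (Finset.sum_le_sum_of_subset_of_nonneg
        (Finset.range_subset_range.mpr (show J ≤ ℓ - 1 by omega)) fun _ _ _ => by positivity)
      refine Finset.sum_le_sum fun j _ => ?_
      refine le_trans (le_of_eq ?_) (h.sum_boundary_le hℓ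
        (f := fun i => (u (r i j) - u (r i (j + 1))) ^ 2) fun i => sq_nonneg _)
      exact Finset.sum_congr rfl fun p _ => (sq _).symm
    linarith
  have hsumE : ∑ j ∈ Finset.range (J + 1), energy (G.induce Γ) (x (j + 1)) ≤
      M ^ 2 * (4 * M * energy G u) := by
    calc _ ≤ ∑ j ∈ Finset.range (J + 1), M ^ 2 * e j := Finset.sum_le_sum fun j _ => hxs j
      _ = M ^ 2 * ∑ j ∈ Finset.range (J + 1), e j := by rw [Finset.mul_sum]
      _ ≤ M ^ 2 * ∑ j ∈ Finset.range ℓ, e j := by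
          gcongr
          · exact fun j _ _ => he j
          · omega
      _ ≤ _ := by gcongr
  have hsumE' : ∑ j ∈ Finset.range (J + 1), energy (G.induce Γ) (x j) ≤
      energy G u + M ^ 2 * (4 * M * energy G u) := by
    have h1 : ∑ j ∈ Finset.range (J + 1), energy (G.induce Γ) (x j) ≤
        ∑ j ∈ Finset.range (J + 1 + 1), energy (G.induce Γ) (x j) :=
      Finset.sum_le_sum_of_subset_of_nonneg (Finset.range_subset_range.mpr (Nat.le_succ _))
        fun _ _ _ => energy_nonneg _ _
    rw [Finset.sum_range_succ' _ (J + 1)] at h1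
    linarith
  rw [Finset.sum_add_distrib, ← Finset.sum_div, Finset.sum_add_distrib] at htel
  have hM2 : (M : ℝ) ^ 2 * energy G u ≤ M ^ 3 * energy G u := by
    gcongr
    norm_num
  have hM3 : energy G u ≤ M ^ 3 * energy G u := le_mul_of_one_le_left hE (one_le_pow₀ hM)
  change B *ᵥ x 0 ⬝ᵥ x 0 ≤ _
  -- The terms are `8c` from the last layer, `5` from the differences and `1/2 + 4` from the layer
  -- energies, each times at most `M ^ 3`.
  nlinarith

end IsLabelling

end LowerBound

/-! ### The upper bound -/

section UpperBound

open Matrix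
open scoped Classical

/-- A bound for the energy from a bound for the contribution of each edge in terms of its ends. -/
theorem energy_le_mul_sum {V : Type*} [Fintype V] (G : SimpleGraph V) (S : Set V) (u F : V → ℝ)
    (D : ℕ) (hF : ∀ p, 0 ≤ F p) (hS : ∀ p q, G.Adj p q → p ∉ S → u p = u q)
    (hD : ∀ p ∈ S, (Finset.univ.filter fun q => G.Adj p q ∧ q ∈ S).card ≤ D)
    (hu : ∀ p q, G.Adj p q → p ∈ S → q ∈ S → (u p - u q) ^ 2 ≤ F p + F q) :
    energy G u ≤ D * ∑ p, if p ∈ S then F p else 0 := by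
  -- Each edge is charged to both of its ends; edges that leave `S` contribute nothing.
  let T : V → V → ℝ := fun p q => if G.Adj p q ∧ p ∈ S ∧ q ∈ S then F p else 0
  have hT : ∑ p, ∑ q, T p q ≤ D * ∑ p, if p ∈ S then F p else 0 := by
    rw [Finset.mul_sum]
    refine Finset.sum_le_sum fun p _ => ?_
    by_cases hp : p ∈ S
    · simp only [T, hp, true_and, if_true]
      rw [← Finset.sum_filter, Finset.sum_const, nsmul_eq_mul]
      exact mul_le_mul_of_nonneg_right (by exact_mod_cast hD p hp) (hF p)
    · simp [T, hp]
  have h1 : ∀ p q, (if G.Adj p q then (u p - u q) ^ 2 else 0) ≤ T p q + T q p := by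
    intro p q
    by_cases hpq : G.Adj p q
    · by_cases hp : p ∈ S
      · by_cases hq : q ∈ S
        · simpa [T, hpq, hpq.symm, hp, hq] using hu p q hpq hp hq
        · simp [T, hpq, hp, hq, hS q p hpq.symm hq]
      · simp [T, hpq, hp, hS p q hpq hp]
    · have hqp : ¬ G.Adj q p := fun h => hpq h.symm
      simp [T, hpq, hqp]
  have h2 : ∑ p, ∑ q, (if G.Adj p q then (u p - u q) ^ 2 else 0) ≤
      ∑ p, ∑ q, T p q + ∑ p, ∑ q, T p q := by
    calc _ ≤ ∑ p, ∑ q, (T p q + T q p) :=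
          Finset.sum_le_sum fun p _ => Finset.sum_le_sum fun q _ => h1 p q
      _ = _ := by
          simp only [Finset.sum_add_distrib]
          rw [Finset.sum_comm (f := fun p q => T q p)]
  unfold energy
  linarith

theorem sum_sq_le_of_sum_eq_zero {W : Type*} [Fintype W] (x : W → ℝ) (hx : ∑ p, x p = 0) (a : ℝ) :
    x ⬝ᵥ x ≤ ∑ p, (x p - a) ^ 2 := by
  have h1 : ∑ p, (x p - a) ^ 2 = x ⬝ᵥ x - 2 * a * ∑ p, x p + ∑ _p : W, a ^ 2 := by
    rw [dotProduct, Finset.mul_sum, ← Finset.sum_sub_distrib, ← Finset.sum_add_distrib]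
    exact Finset.sum_congr rfl fun p _ => by ring
  rw [h1, hx]
  have : 0 ≤ ∑ _p : W, a ^ 2 := Finset.sum_nonneg fun _ _ => sq_nonneg a
  linarith

/-- The mean is the best constant, so comparison with the value at one vertex suffices. -/
theorem dotProduct_self_le_card_sq_mul_energy {W : Type*} [Fintype W] {K : SimpleGraph W}
    (hK : K.Preconnected) (x : W → ℝ) (hx : ∑ p, x p = 0) :
    x ⬝ᵥ x ≤ (Fintype.card W : ℝ) ^ 2 * energy K x := by
  rcases isEmpty_or_nonempty W with hW | ⟨⟨a⟩⟩
  · simp [dotProduct]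
  · calc x ⬝ᵥ x ≤ ∑ p, (x p - x a) ^ 2 := sum_sq_le_of_sum_eq_zero x hx (x a)
      _ ≤ ∑ _p : W, (Fintype.card W : ℝ) * energy K x :=
          Finset.sum_le_sum fun p _ => sq_sub_le_card_mul_energy hK x p a
      _ = _ := by
          rw [Finset.sum_const, Finset.card_univ, nsmul_eq_mul]
          ring

/-- The iterates of `x ↦ x - τ B x`. -/
noncomputable def descent {W : Type*} [Fintype W] (B : Matrix W W ℝ) (τ : ℝ) (ψ : W → ℝ) :
    ℕ → W → ℝ
  | 0 => ψ
  | n + 1 => descent B τ ψ n - τ • B *ᵥ descent B τ ψ n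

section Descent

variable {W : Type*} [Fintype W] {B : Matrix W W ℝ} {τ : ℝ}

theorem descent_dotProduct_le (hB : B.PosSemidef) (hτ : 0 < τ)
    (h : ∀ x : W → ℝ, τ ^ 2 * (B *ᵥ x ⬝ᵥ B *ᵥ x) ≤ x ⬝ᵥ x) (ψ : W → ℝ) (n : ℕ) :
    descent B τ ψ n ⬝ᵥ descent B τ ψ n ≤ ψ ⬝ᵥ ψ := by
  induction n with
  | zero => exact le_rfl
  | succ n ih => exact (dotProduct_step_le hB hτ h _).trans ih

/-- Telescoping the decrease of the form: this sums the energies over all rows without any loss in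
the number of rows. -/
theorem sum_descent_le (hB : B.PosSemidef) (hτ : 0 < τ)
    (h : ∀ x : W → ℝ, τ ^ 2 * (B *ᵥ x ⬝ᵥ B *ᵥ x) ≤ x ⬝ᵥ x) (ψ : W → ℝ) (n : ℕ) :
    τ * ∑ j ∈ Finset.range n, B *ᵥ descent B τ ψ j ⬝ᵥ B *ᵥ descent B τ ψ j ≤ B *ᵥ ψ ⬝ᵥ ψ := by
  have h1 : τ * ∑ j ∈ Finset.range n, B *ᵥ descent B τ ψ j ⬝ᵥ B *ᵥ descent B τ ψ j ≤
      B *ᵥ ψ ⬝ᵥ ψ - B *ᵥ descent B τ ψ n ⬝ᵥ descent B τ ψ n := by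
    rw [Finset.mul_sum]
    refine le_trans (Finset.sum_le_sum fun j _ => mul_dotProduct_le_form_sub hB hτ h _)
      (Finset.sum_range_sub' (fun j => B *ᵥ descent B τ ψ j ⬝ᵥ descent B τ ψ j) n).le
  linarith [form_nonneg hB (descent B τ ψ n)]

end Descent

/-- A cutoff function, equal to `1` on the first of `ℓ` rows and to `0` from the last one on. -/
noncomputable def cutoff (ℓ j : ℕ) : ℝ := ((ℓ - 1 - j : ℕ) : ℝ) / ((ℓ - 1 : ℕ) : ℝ)

theorem cutoff_zero {ℓ : ℕ} (hℓ : 2 ≤ ℓ) : cutoff ℓ 0 = 1 := by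
  have : ((ℓ - 1 : ℕ) : ℝ) ≠ 0 := by
    rw [Nat.cast_ne_zero]
    omega
  simp [cutoff, this]

theorem cutoff_last {ℓ j : ℕ} (hj : ℓ ≤ j + 1) : cutoff ℓ j = 0 := by
  simp [cutoff, show ℓ - 1 - j = 0 by omega]

theorem cutoff_sq_le (ℓ j : ℕ) : cutoff ℓ j ^ 2 ≤ 1 := by
  have h0 : 0 ≤ cutoff ℓ j := by unfold cutoff; positivity
  have h1 : cutoff ℓ j ≤ 1 := by
    unfold cutoff
    refine div_le_one_of_le₀ ?_ (Nat.cast_nonneg _)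
    exact_mod_cast Nat.sub_le _ _
  nlinarith

theorem cutoff_sub_sq_le {ℓ : ℕ} (hℓ : 2 ≤ ℓ) (j : ℕ) :
    (cutoff ℓ (j + 1) - cutoff ℓ j) ^ 2 ≤ 4 / (ℓ : ℝ) ^ 2 := by
  have hL : (0 : ℝ) < ((ℓ - 1 : ℕ) : ℝ) := by
    rw [Nat.cast_pos]
    omega
  -- The slope is at most `1 / (ℓ - 1)`, hence at most `2 / ℓ`.
  have hℓ' : (ℓ : ℝ) ≤ 2 * ((ℓ - 1 : ℕ) : ℝ) := by
    have : ℓ ≤ 2 * (ℓ - 1) := by omega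
    exact_mod_cast this
  have hpos : (0 : ℝ) < ℓ := by
    rw [Nat.cast_pos]
    omega
  unfold cutoff
  rw [← sub_div, div_pow, div_le_div_iff₀ (by positivity) (by positivity)]
  have h1 : ((((ℓ - 1 - (j + 1) : ℕ) : ℝ)) - ((ℓ - 1 - j : ℕ) : ℝ)) ^ 2 ≤ 1 := by
    rcases Nat.lt_or_ge j (ℓ - 1) with h | h
    · have : ℓ - 1 - j = ℓ - 1 - (j + 1) + 1 := by omega
      rw [this]
      push_cast
      ring_nf
      rfl
    · rw [show ℓ - 1 - j = 0 by omega, show ℓ - 1 - (j + 1) = 0 by omega]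
      simp
  calc _ ≤ 1 * (ℓ : ℝ) ^ 2 := by gcongr
    _ ≤ 1 * (2 * ((ℓ - 1 : ℕ) : ℝ)) ^ 2 := by gcongr
    _ = _ := by ring

/-! ### Degree bounds and overlapping boundary windows -/

namespace IsLabelling

set_option linter.unusedSectionVars false

variable {V : Type*} [Fintype V] {G : SimpleGraph V} {Γ : Set V} {k ℓ M : ℕ} [NeZero k]
  {col : V → Fin k} {row : V → ℕ}

theorem near_mem {i i' : Fin k} (h : Near i i') : i' ∈ ({i, i + 1, i - 1} : Finset (Fin k)) := by
  rcases h with h | h | h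
  · simp [h]
  · simp [h]
  · simp [h]

theorem card_neighbors_le (h : IsLabelling G Γ k ℓ M col row) {p : V} (hp : row p < ℓ) :
    (Finset.univ.filter fun q => G.Adj p q ∧ q ∈ {q | row q < ℓ}).card ≤ 9 * M := by
  -- Neighbors lie in a block of three columns by three rows; in row `0` truncation repeats a row.
  let I : Finset (Fin k × ℕ) := {col p, col p + 1, col p - 1} ×ˢ {row p, row p + 1, row p - 1}
  have hI : I.card ≤ 9 := by
    rw [Finset.card_product]
    exact Nat.mul_le_mul Finset.card_le_three Finset.card_le_three
  have hsub : (Finset.univ.filter fun q => G.Adj p q ∧ q ∈ {q | row q < ℓ}) ⊆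
      I.biUnion fun x => Finset.univ.filter fun q => q ∈ cell col row x.1 x.2 ∧ row q < ℓ := by
    intro q hq
    simp only [Finset.mem_filter, Finset.mem_univ, true_and, Set.mem_ofPred_eq] at hq
    rw [Finset.mem_biUnion]
    refine ⟨(col q, row q), Finset.mem_product.mpr ⟨near_mem (h.near hq.1 hp hq.2), ?_⟩, ?_⟩
    · have h1 := h.row_le hq.1 hp hq.2
      have h2 := h.row_le hq.1.symm hq.2 hp
      have : row q = row p ∨ row q = row p + 1 ∨ row q = row p - 1 := by omega
      simpa using this
    · simp only [Finset.mem_filter, Finset.mem_univ, true_and]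
      exact ⟨⟨rfl, rfl⟩, hq.2⟩
  refine (Finset.card_le_card hsub).trans ((Finset.card_biUnion_le_card_mul _ _ M ?_).trans ?_)
  · intro x _
    by_cases hx : x.2 < ℓ
    · refine le_trans ?_ (h.ncard_le x.1 x.2 hx)
      rw [Set.ncard_eq_toFinset_card']
      refine Finset.card_le_card fun q hq => ?_
      simp only [Finset.mem_filter] at hq
      simpa using hq.2.1
    · rw [Finset.card_eq_zero.mpr]
      · exact Nat.zero_le _
      · refine Finset.filter_eq_empty_iff.mpr ?_
        rintro q - ⟨⟨-, h1⟩, h2⟩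
        omega
  · exact Nat.mul_le_mul_right M hI

theorem card_boundary_neighbors_le (h : IsLabelling G Γ k ℓ M col row) (hℓ : 0 < ℓ) (p : Γ) :
    (Finset.univ.filter fun q => (G.induce Γ).Adj p q ∧ q ∈ (Set.univ : Set Γ)).card ≤ 3 * M := by
  have hsub : (Finset.univ.filter fun q => (G.induce Γ).Adj p q ∧ q ∈ (Set.univ : Set Γ)) ⊆
      ({col p, col p + 1, col p - 1} : Finset (Fin k)).biUnion fun i =>
        Finset.univ.filter fun q : Γ => col q = i := by
    intro q hq
    simp only [Finset.mem_filter, Finset.mem_univ, true_and, Set.mem_univ, and_true] at hq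
    rw [Finset.mem_biUnion]
    exact ⟨col q, near_mem (h.near_boundary hℓ hq), by simp⟩
  refine (Finset.card_le_card hsub).trans ((Finset.card_biUnion_le_card_mul _ _ M ?_).trans ?_)
  · exact fun i _ => h.card_boundary_col_le hℓ i
  · exact Nat.mul_le_mul_right M Finset.card_le_three

theorem energy_boundary_le_mul_dotProduct (h : IsLabelling G Γ k ℓ M col row) (hℓ : 0 < ℓ)
    (x : Γ → ℝ) : energy (G.induce Γ) x ≤ 6 * M * (x ⬝ᵥ x) := by
  have := energy_le_mul_sum (G.induce Γ) Set.univ x (fun p => 2 * x p ^ 2) (3 * M)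
    (fun p => by positivity) (fun p q _ hp => absurd (Set.mem_univ p) hp)
    (fun p _ => by convert h.card_boundary_neighbors_le hℓ p)
    (fun p q _ _ _ => by nlinarith [sq_nonneg (x p + x q)])
  refine this.trans (le_of_eq ?_)
  simp only [Set.mem_univ, if_true, ← Finset.mul_sum, dotProduct]
  push_cast
  simp only [← sq]
  ring

theorem sum_rows_le (h : IsLabelling G Γ k ℓ M col row) {f : Fin k → ℕ → ℝ}
    (hf : ∀ i j, 0 ≤ f i j) :
    ∑ p, (if row p < ℓ then f (col p) (row p) else 0) ≤
      M * ∑ j ∈ Finset.range ℓ, ∑ i, f i j := by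
  have h1 : ∀ p, (if row p < ℓ then f (col p) (row p) else 0) =
      ∑ j ∈ Finset.range ℓ, ∑ i, if p ∈ cell col row i j then f i j else 0 := by
    intro p
    have h2 : ∀ j, (∑ i, if p ∈ cell col row i j then f i j else 0) =
        if row p = j then f (col p) j else 0 := by
      intro j
      rw [Finset.sum_eq_single (col p)]
      · simp [cell]
      · intro i _ hi
        rw [if_neg fun hp => hi hp.1.symm]
      · simp
    simp only [h2, Finset.sum_ite_eq, Finset.mem_range]
  simp only [h1]
  rw [Finset.sum_comm, Finset.mul_sum]
  refine Finset.sum_le_sum fun j hj => ?_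
  rw [Finset.sum_comm, Finset.mul_sum]
  refine Finset.sum_le_sum fun i _ => ?_
  rw [← Finset.sum_filter, Finset.sum_const, nsmul_eq_mul]
  refine mul_le_mul_of_nonneg_right ?_ (hf i j)
  have := h.ncard_le i j (Finset.mem_range.mp hj)
  rw [Set.ncard_eq_toFinset_card'] at this
  refine le_trans ?_ (Nat.cast_le.mpr this)
  refine Nat.cast_le.mpr (Finset.card_le_card fun q hq => ?_)
  simp only [Finset.mem_filter] at hq
  simpa using hq.2

/-- The vertices of the boundary in two consecutive columns. -/
def window (Γ : Set V) (col : V → Fin k) (i : Fin k) : Set Γ := {p | col p = i ∨ col p = i + 1}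

theorem sum_window_le (x : Γ → ℝ) :
    ∑ i, localEnergy (G.induce Γ) (window Γ col i) x ≤ 2 * energy (G.induce Γ) x := by
  have := sum_localEnergy_le (G.induce Γ) (Finset.univ : Finset (Fin k))
    (window Γ col) 2 (fun p => by
      refine (Finset.card_le_card (t := {col p, col p - 1}) ?_).trans Finset.card_le_two
      intro i hx
      simp only [Finset.mem_filter] at hx
      rcases hx.2 with h1 | h1
      · simp [h1]
      · simp [h1]) x
  simpa using this

theorem sq_sub_le_window (h : IsLabelling G Γ k ℓ M col row) (hℓ : 0 < ℓ)
    (hconn : ∀ i, ((G.induce Γ).induce (window Γ col i)).Preconnected) (x : Γ → ℝ) {i : Fin k}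
    {p q : Γ} (hp : p ∈ window Γ col i) (hq : q ∈ window Γ col i) :
    (x p - x q) ^ 2 ≤ 2 * M * localEnergy (G.induce Γ) (window Γ col i) x := by
  have h1 : (window Γ col i).ncard ≤ 2 * M := by
    rw [Set.ncard_eq_toFinset_card']
    refine (Finset.card_le_card (t := (Finset.univ.filter fun p : Γ => col p = i) ∪
      (Finset.univ.filter fun p : Γ => col p = i + 1)) ?_).trans ?_
    · intro p hp
      have hp : p ∈ window Γ col i := Set.mem_toFinset.mp hp
      have hp : col p = i ∨ col p = i + 1 := hp
      simpa using hp
    · refine (Finset.card_union_le _ _).trans ?_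
      linarith [h.card_boundary_col_le hℓ i, h.card_boundary_col_le hℓ (i + 1)]
  have := sq_sub_le_mul_localEnergy (hconn i) h1 x hp hq
  simpa using this

/-- Consecutive windows share a column that meets `Γ`, so they chain around the whole cycle. -/
theorem preconnected_boundary (h : IsLabelling G Γ k ℓ M col row)
    (hconn : ∀ i, ((G.induce Γ).induce (window Γ col i)).Preconnected) :
    (G.induce Γ).Preconnected := by
  have hwin : ∀ (i : Fin k) (p q : Γ), p ∈ window Γ col i → q ∈ window Γ col i →
      (G.induce Γ).Reachable p q := by
    intro i p q hp hq
    exact (hconn i ⟨p, hp⟩ ⟨q, hq⟩).map (Embedding.induce _).toHom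
  have hn : ∀ (n : ℕ) (p q : Γ), col q = col p + Fin.ofNat k n → (G.induce Γ).Reachable p q := by
    intro n
    induction n with
    | zero =>
      intro p q hq
      have h0 : Fin.ofNat k 0 = 0 := rfl
      rw [h0, add_zero] at hq
      exact hwin (col p) p q (Or.inl rfl) (Or.inl hq)
    | succ n ih =>
      intro p q hq
      obtain ⟨r, hr, hrc⟩ := h.boundary_col (col p + Fin.ofNat k n)
      refine (ih p ⟨r, hr⟩ hrc).trans (hwin (col r) _ _ (Or.inl rfl) (Or.inr ?_))
      rw [hq, hrc, add_assoc]
      congr 1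
      ext
      simp [Fin.val_add]
  intro p q
  refine hn (col q - col p).val p q ?_
  have : Fin.ofNat k (col q - col p).val = col q - col p := by ext; simp
  rw [this]
  simp

theorem card_boundary_le (h : IsLabelling G Γ k ℓ M col row) (hℓ : 0 < ℓ) :
    (Fintype.card Γ : ℝ) ≤ k * M := by
  have := h.sum_boundary_le hℓ (f := fun _ => 1) fun _ => zero_le_one
  simpa [mul_comm] using this

end IsLabelling

end UpperBound

/-! ### Extension of boundary data into the annulus -/

section Extension

open Matrix
open scoped Classical

namespace IsLabelling

variable {V : Type*} [Fintype V] {G : SimpleGraph V} {Γ : Set V} {k ℓ M : ℕ} [NeZero k]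
  {col : V → Fin k} {row : V → ℕ}

/-- The sum of the squared increments of `U` along the edges of the annulus to which an edge of `G`
with lower end in column `i` and row `j` is compared. -/
noncomputable def increments (U : Fin k → ℕ → ℝ) (i : Fin k) (j : ℕ) : ℝ :=
  (U (i + 1) j - U i j) ^ 2 + (U (i - 1 + 1) j - U (i - 1) j) ^ 2 + (U i (j + 1) - U i j) ^ 2 +
    (U (i + 1) (j + 1) - U (i + 1) j) ^ 2 + (U (i - 1) (j + 1) - U (i - 1) j) ^ 2

theorem increments_nonneg (U : Fin k → ℕ → ℝ) (i : Fin k) (j : ℕ) : 0 ≤ increments U i j := by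
  unfold increments
  positivity

theorem sum_increments (U : Fin k → ℕ → ℝ) (j : ℕ) :
    ∑ i, increments U i j =
      2 * cycleEnergy (fun i => U i j) + 3 * ∑ i, (U i (j + 1) - U i j) ^ 2 := by
  simp only [increments, Finset.sum_add_distrib, cycleEnergy]
  have h1 : ∑ i, (U (i - 1 + 1) j - U (i - 1) j) ^ 2 = ∑ i, (U (i + 1) j - U i j) ^ 2 :=
    (Equiv.subRight (1 : Fin k)).sum_comp fun i => (U (i + 1) j - U i j) ^ 2
  have h2 : ∑ i, (U (i + 1) (j + 1) - U (i + 1) j) ^ 2 = ∑ i, (U i (j + 1) - U i j) ^ 2 :=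
    Equiv.sum_comp (Equiv.addRight (1 : Fin k)) fun i => (U i (j + 1) - U i j) ^ 2
  have h3 : ∑ i, (U (i - 1) (j + 1) - U (i - 1) j) ^ 2 = ∑ i, (U i (j + 1) - U i j) ^ 2 :=
    (Equiv.subRight (1 : Fin k)).sum_comp fun i => (U i (j + 1) - U i j) ^ 2
  rw [h1, h2, h3]
  ring

/-- A diagonal is a horizontal step followed by a vertical one in the neighboring column; this costs
the factor `2`. -/
theorem sq_sub_le_increments (U : Fin k → ℕ → ℝ) {i i' : Fin k} (h : Near i i') (j : ℕ) :
    (U i j - U i' j) ^ 2 ≤ 2 * increments U i j ∧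
      (U i j - U i' (j + 1)) ^ 2 ≤ 2 * increments U i j := by
  unfold increments
  have hsq : ∀ a b : ℝ, (a - b) ^ 2 = (b - a) ^ 2 := fun a b => by ring
  have htri : ∀ a b c : ℝ, (a - c) ^ 2 ≤ 2 * (b - a) ^ 2 + 2 * (c - b) ^ 2 := fun a b c => by
    nlinarith [sq_nonneg (a - b - (b - c))]
  have h1 := sq_nonneg (U (i + 1) j - U i j)
  have h2 := sq_nonneg (U (i - 1 + 1) j - U (i - 1) j)
  have h3 := sq_nonneg (U i (j + 1) - U i j)
  have h4 := sq_nonneg (U (i + 1) (j + 1) - U (i + 1) j)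
  have h5 := sq_nonneg (U (i - 1) (j + 1) - U (i - 1) j)
  rcases h with h | h | h
  · subst h
    constructor
    · rw [sub_self]
      nlinarith
    · linarith [hsq (U i' j) (U i' (j + 1))]
  · subst h
    constructor
    · linarith [hsq (U i j) (U (i + 1) j)]
    · linarith [htri (U i j) (U (i + 1) j) (U (i + 1) (j + 1))]
  · have h6 : i' = i - 1 := by rw [h]; simp
    subst h6
    have h7 : i - 1 + 1 = i := by simp
    rw [h7] at h2 ⊢
    constructor
    · linarith
    · linarith [htri (U i j) (U (i - 1) j) (U (i - 1) (j + 1)), hsq (U i j) (U (i - 1) j)]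

/-- The energy of a function that depends on rows and columns only, up to a perturbation on the
boundary. -/
theorem energy_extension_le (h : IsLabelling G Γ k ℓ M col row) (hℓ : 2 ≤ ℓ)
    (U : Fin k → ℕ → ℝ) (m : ℝ) (hU : ∀ i j, ℓ ≤ j + 1 → U i j = m)
    (ε : V → ℝ) (hε : ∀ p ∉ Γ, ε p = 0) :
    energy G (fun p => U (col p) (row p) + ε p) ≤
      27 * M * ∑ p : Γ, ε p ^ 2 + 54 * M ^ 2 * ∑ j ∈ Finset.range ℓ,
        (2 * cycleEnergy (fun i => U i j) + 3 * ∑ i, (U i (j + 1) - U i j) ^ 2) := by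
  have hε' : ∀ p, 0 < row p → ε p = 0 := fun p hp => hε p fun hpΓ => by
    rw [h.boundary_row p hpΓ] at hp
    exact lt_irrefl 0 hp
  -- The `3` comes from squaring a sum of three terms, and `6 = 3 * 2` from the diagonals.
  let F : V → ℝ := fun p => 3 * ε p ^ 2 + 6 * increments U (col p) (row p)
  have hF : ∀ p, 0 ≤ F p := fun p => by
    have := increments_nonneg U (col p) (row p)
    positivity
  have hstar : ∀ p q, G.Adj p q → p ∉ {p | row p < ℓ} →
      U (col p) (row p) + ε p = U (col q) (row q) + ε q := by
    intro p q hpq hp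
    have hp : ℓ ≤ row p := not_lt.mp hp
    -- The rows from `ℓ` on touch only row `ℓ - 1`, where `U` is already the constant `m`, and `ℓ -
    -- 1 > 0` keeps `ε` out.
    have hq : ℓ ≤ row q + 1 := by
      by_contra hq
      have := h.last_row hpq.symm (by omega) hp
      omega
    rw [hU _ _ hq, hU _ _ (by omega), hε' p (by omega), hε' q (by omega)]
  have hedge : ∀ p q, G.Adj p q → p ∈ {p | row p < ℓ} → q ∈ {p | row p < ℓ} →
      (U (col p) (row p) + ε p - (U (col q) (row q) + ε q)) ^ 2 ≤ F p + F q := by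
    intro p q hpq hp hq
    have hp : row p < ℓ := hp
    have hq : row q < ℓ := hq
    have h1 : (U (col p) (row p) - U (col q) (row q)) ^ 2 ≤
        2 * increments U (col p) (row p) + 2 * increments U (col q) (row q) := by
      have hn := h.near hpq hp hq
      have h2 := h.row_le hpq hp hq
      have h3 := h.row_le hpq.symm hq hp
      have h4 := increments_nonneg U (col p) (row p)
      have h5 := increments_nonneg U (col q) (row q)
      have h6 := sq_sub_le_increments U hn (row p)
      have h7 := sq_sub_le_increments U hn.symm (row q)
      have h8 : row q = row p ∨ row q = row p + 1 ∨ row p = row q + 1 := by omega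
      rcases h8 with h8 | h8 | h8
      · rw [h8] at h5 ⊢
        linarith [h6.1]
      · rw [← h8] at h6
        linarith [h6.2]
      · rw [← h8] at h7
        have : (U (col p) (row p) - U (col q) (row q)) ^ 2 =
          (U (col q) (row q) - U (col p) (row p)) ^ 2 := by ring
        linarith [h7.2]
    set a := U (col p) (row p) - U (col q) (row q) with ha
    have h9 : (U (col p) (row p) + ε p - (U (col q) (row q) + ε q)) ^ 2 ≤
        3 * a ^ 2 + 3 * ε p ^ 2 + 3 * ε q ^ 2 := by
      rw [show U (col p) (row p) + ε p - (U (col q) (row q) + ε q) = a + ε p - ε q by rw [ha]; ring]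
      nlinarith [sq_nonneg (a - ε p), sq_nonneg (a + ε q), sq_nonneg (ε p + ε q)]
    simp only [F]
    linarith
  have hmain := energy_le_mul_sum G {p | row p < ℓ} (fun p => U (col p) (row p) + ε p) F (9 * M) hF
    hstar (fun p hp => by convert h.card_neighbors_le hp) hedge
  have hsum : ∑ p, (if p ∈ {p | row p < ℓ} then F p else 0) ≤
      3 * ∑ p : Γ, ε p ^ 2 + 6 * (M * ∑ j ∈ Finset.range ℓ, ∑ i, increments U i j) := by
    have h1 : ∑ p, ε p ^ 2 = ∑ p : Γ, ε p ^ 2 := by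
      rw [← Fintype.sum_subtype_add_sum_subtype (· ∈ Γ)]
      rw [Finset.sum_eq_zero (s := (Finset.univ : Finset {x // x ∉ Γ}))
        fun p _ => by rw [hε p p.2]; simp, add_zero]
    have h2 := h.sum_rows_le (f := increments U) (increments_nonneg U)
    have h3 : ∀ p, (if p ∈ {p | row p < ℓ} then F p else 0) ≤ 3 * ε p ^ 2 +
        6 * (if row p < ℓ then increments U (col p) (row p) else 0) := by
      intro p
      by_cases hp : row p < ℓ
      · simp [hp, F]
      · simp only [hp, if_false, Set.mem_ofPred_eq]
        positivity
    refine (Finset.sum_le_sum fun p _ => h3 p).trans ?_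
    rw [Finset.sum_add_distrib, ← Finset.mul_sum, ← Finset.mul_sum, h1]
    linarith
  refine hmain.trans ?_
  push_cast
  calc _ ≤ 9 * (M : ℝ) * (3 * ∑ p : Γ, ε p ^ 2 +
        6 * (M * ∑ j ∈ Finset.range ℓ, ∑ i, increments U i j)) := by
        refine mul_le_mul_of_nonneg_left (le_of_eq_of_le ?_ hsum) (by positivity)
        exact Finset.sum_congr rfl fun p _ => by congr
    _ = _ := by
      simp only [sum_increments]
      ring

/-- The extension inequality: a function on the boundary has an extension whose energy is controlled
by the form of the square root of the boundary Laplacian. -/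
theorem exists_extension (h : IsLabelling G Γ k ℓ M col row) (hℓ : 2 ≤ ℓ) {c : ℕ}
    (hkc : k ≤ 2 * c * ℓ)
    (hconn : ∀ i, ((G.induce Γ).induce (window Γ col i)).Preconnected) (φ : Γ → ℝ) :
    ∃ u : V → ℝ, (∀ p : Γ, u p = φ p) ∧ energy G u ≤ (2000 + 3000 * c) * M ^ 4 *
      (cfc Real.sqrt ((G.induce Γ).lapMatrix ℝ) *ᵥ φ ⬝ᵥ φ) := by
  set B := cfc Real.sqrt ((G.induce Γ).lapMatrix ℝ) with hBdef
  have hB : B.PosSemidef := posSemidef_cfc_sqrt _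
  have hBB : ∀ x, B *ᵥ x ⬝ᵥ B *ᵥ x = energy (G.induce Γ) x :=
    fun x => sqrt_lapMatrix_dotProduct_self _ x
  have hB1 : ∀ a : ℝ, B *ᵥ (fun _ => a) = 0 := fun a => sqrt_lapMatrix_mulVec_const _ a
  have hℓ0 : 0 < ℓ := by omega
  have hℓR : (0 : ℝ) < ℓ := Nat.cast_pos.mpr hℓ0
  have hM : (1 : ℝ) ≤ M := by exact_mod_cast h.one_le hℓ0
  have hM0 : (0 : ℝ) < M := by linarith
  choose b hbΓ hbcol using h.boundary_col
  let β : Fin k → Γ := fun i => ⟨b i, hbΓ i⟩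
  have hβ : Function.Injective β := fun i i' hii' => by
    rw [← hbcol i, ← hbcol i']
    exact congrArg (fun p : Γ => col p) hii'
  have hΓ0 : (Fintype.card Γ : ℝ) ≠ 0 := by
    have : Nonempty Γ := ⟨β 0⟩
    positivity
  -- Removing the mean makes the spectral gap available and leaves the form of `B` unchanged.
  set m : ℝ := (∑ p, φ p) / Fintype.card Γ with hm
  let ψ : Γ → ℝ := φ - fun _ => m
  have hψ0 : ∑ p, ψ p = 0 := by
    simp only [ψ, Pi.sub_apply, Finset.sum_sub_distrib, Finset.sum_const, Finset.card_univ,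
      nsmul_eq_mul, hm]
    field_simp
    ring
  have hBψ : B *ᵥ ψ = B *ᵥ φ := by simp only [ψ, mulVec_sub, hB1, sub_zero]
  have hform : B *ᵥ ψ ⬝ᵥ ψ = B *ᵥ φ ⬝ᵥ φ := by
    rw [hBψ, dotProduct_sub, mulVec_dotProduct_comm hB φ (fun _ => m), hB1]
    simp
  set Q := B *ᵥ φ ⬝ᵥ φ with hQ
  have hQ0 : 0 ≤ Q := form_nonneg hB φ
  -- The energy bound `6 * M` on the boundary makes `τ B` a contraction, as `6 * M ≤ (3 * M) ^ 2`.
  let τ : ℝ := 1 / (3 * M)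
  have hτ : 0 < τ := by positivity
  have hτM : τ * (3 * M) = 1 := by
    simp only [τ]
    field_simp
  have hstep : ∀ x : Γ → ℝ, τ ^ 2 * (B *ᵥ x ⬝ᵥ B *ᵥ x) ≤ x ⬝ᵥ x := by
    intro x
    have h1 := h.energy_boundary_le_mul_dotProduct hℓ0 x
    have h2 := dotProduct_self_nonneg' x
    rw [hBB]
    calc τ ^ 2 * energy (G.induce Γ) x ≤ τ ^ 2 * (6 * M * (x ⬝ᵥ x)) := by gcongr
      _ ≤ τ ^ 2 * ((3 * M) ^ 2 * (x ⬝ᵥ x)) := by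
          gcongr
          nlinarith
      _ = (τ * (3 * M)) ^ 2 * (x ⬝ᵥ x) := by ring
      _ = x ⬝ᵥ x := by rw [hτM]; ring
  have hgap : ψ ⬝ᵥ ψ ≤ k * M * Q := by
    have hk0 : (0 : ℝ) < k := Nat.cast_pos.mpr (Nat.pos_of_ne_zero (NeZero.ne k))
    rw [← hform]
    refine dotProduct_le_mul_form hB (hB1 1) (by positivity) (fun x hx => ?_) ψ hψ0
    refine (dotProduct_self_le_card_sq_mul_energy (h.preconnected_boundary hconn) x hx).trans ?_
    rw [hBB]
    have := energy_nonneg (G.induce Γ) x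
    have := h.card_boundary_le hℓ0
    gcongr
  let v : ℕ → Γ → ℝ := descent B τ ψ
  have hv_succ : ∀ j, v (j + 1) - v j = -(τ • B *ᵥ v j) := fun j => by
    simp only [v, descent]
    abel
  have hsumE : ∑ j ∈ Finset.range ℓ, energy (G.induce Γ) (v j) ≤ 3 * M * Q := by
    have h1 := sum_descent_le hB hτ hstep ψ ℓ
    rw [hform] at h1
    simp only [hBB] at h1
    calc _ = (τ * (3 * M)) * ∑ j ∈ Finset.range ℓ, energy (G.induce Γ) (v j) := by
          rw [hτM, one_mul]
      _ = 3 * M * (τ * ∑ j ∈ Finset.range ℓ, energy (G.induce Γ) (v j)) := by ring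
      _ ≤ _ := by gcongr
  let U : Fin k → ℕ → ℝ := fun i j => m + cutoff ℓ j * v j (β i)
  -- `U` matches `φ` only at the chosen vertices `β i`; `ε` corrects the other boundary vertices.
  let ε : V → ℝ := fun p => if hp : p ∈ Γ then φ ⟨p, hp⟩ - φ (β (col p)) else 0
  have hUm : ∀ i j, ℓ ≤ j + 1 → U i j = m := fun i j hj => by
    simp only [U, cutoff_last hj, zero_mul, add_zero]
  refine ⟨fun p => U (col p) (row p) + ε p, fun p => ?_, ?_⟩
  · simp only [U, ε, h.boundary_row p p.2, cutoff_zero hℓ, v, descent, ψ, Pi.sub_apply, p.2,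
      dif_pos]
    ring
  have hεsum : ∑ p : Γ, ε p ^ 2 ≤ 12 * M ^ 3 * Q := by
    calc _ ≤ ∑ p : Γ, 2 * M * localEnergy (G.induce Γ) (window Γ col (col p)) φ := by
          refine Finset.sum_le_sum fun p _ => ?_
          simp only [ε, p.2, dif_pos]
          exact h.sq_sub_le_window hℓ0 hconn φ (Or.inl rfl) (Or.inl (hbcol _))
      _ = 2 * M * ∑ p : Γ, localEnergy (G.induce Γ) (window Γ col (col p)) φ := by
          rw [Finset.mul_sum]
      _ ≤ 2 * M * (M * ∑ i, localEnergy (G.induce Γ) (window Γ col i) φ) := by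
          gcongr
          exact h.sum_boundary_le hℓ0
            (f := fun i => localEnergy (G.induce Γ) (window Γ col i) φ)
            fun i => localEnergy_nonneg _ _ _
      _ ≤ 2 * M * (M * (2 * energy (G.induce Γ) φ)) := by
          gcongr
          exact sum_window_le φ
      _ ≤ 2 * M * (M * (2 * (3 * M * Q))) := by
          gcongr
          have h1 := mul_dotProduct_le_form hB hτ hstep φ
          rw [hBB] at h1
          calc energy (G.induce Γ) φ = (τ * (3 * M)) * energy (G.induce Γ) φ := by
                rw [hτM, one_mul]
            _ = 3 * M * (τ * energy (G.induce Γ) φ) := by ring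
            _ ≤ _ := by gcongr
      _ = _ := by ring
  have hH : ∑ j ∈ Finset.range ℓ, cycleEnergy (fun i => U i j) ≤ 12 * M ^ 2 * Q := by
    have h1 : ∀ j, cycleEnergy (fun i => U i j) ≤ 4 * M * energy (G.induce Γ) (v j) := by
      intro j
      calc cycleEnergy (fun i => U i j)
          = cutoff ℓ j ^ 2 * ∑ i, (v j (β (i + 1)) - v j (β i)) ^ 2 := by
            simp only [cycleEnergy, U]
            rw [Finset.mul_sum]
            exact Finset.sum_congr rfl fun i _ => by ring
        _ ≤ 1 * ∑ i, (v j (β (i + 1)) - v j (β i)) ^ 2 := by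
            gcongr
            exact cutoff_sq_le ℓ j
        _ ≤ 1 * ∑ i, 2 * M * localEnergy (G.induce Γ) (window Γ col i) (v j) := by
            gcongr with i
            exact h.sq_sub_le_window hℓ0 hconn (v j) (Or.inr (hbcol _)) (Or.inl (hbcol _))
        _ = 2 * M * ∑ i, localEnergy (G.induce Γ) (window Γ col i) (v j) := by
            rw [one_mul, Finset.mul_sum]
        _ ≤ 2 * M * (2 * energy (G.induce Γ) (v j)) := by
            gcongr
            exact sum_window_le (v j)
        _ = _ := by ring
    calc _ ≤ ∑ j ∈ Finset.range ℓ, 4 * M * energy (G.induce Γ) (v j) :=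
          Finset.sum_le_sum fun j _ => h1 j
      _ = 4 * M * ∑ j ∈ Finset.range ℓ, energy (G.induce Γ) (v j) := by rw [Finset.mul_sum]
      _ ≤ 4 * M * (3 * M * Q) := by gcongr
      _ = _ := by ring
  have hinj : ∀ f : Γ → ℝ, ∑ i, f (β i) ^ 2 ≤ f ⬝ᵥ f := by
    intro f
    have h1 : ∑ i, f (β i) ^ 2 = ∑ p ∈ Finset.univ.image β, f p ^ 2 := by
      rw [Finset.sum_image fun i _ i' _ hii' => hβ hii']
    rw [h1]
    calc _ ≤ ∑ p, f p ^ 2 := Finset.sum_le_sum_of_subset_of_nonneg (Finset.subset_univ _)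
          fun _ _ _ => sq_nonneg _
      _ = f ⬝ᵥ f := Finset.sum_congr rfl fun p _ => sq _
  have hV : ∑ j ∈ Finset.range ℓ, ∑ i, (U i (j + 1) - U i j) ^ 2 ≤ (1 + 16 * c * M) * Q := by
    have h1 : ∀ j, ∑ i, (U i (j + 1) - U i j) ^ 2 ≤
        2 * τ ^ 2 * energy (G.induce Γ) (v j) + 8 / ℓ ^ 2 * (ψ ⬝ᵥ ψ) := by
      intro j
      have h2 : ∀ i, (U i (j + 1) - U i j) ^ 2 ≤
          2 * (v (j + 1) - v j) (β i) ^ 2 + 8 / ℓ ^ 2 * v j (β i) ^ 2 := by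
        intro i
        have h3 := cutoff_sq_le ℓ (j + 1)
        have h4 := cutoff_sub_sq_le hℓ j
        set s := cutoff ℓ (j + 1)
        set t := cutoff ℓ j
        set y := v (j + 1) (β i) - v j (β i) with hy
        set z := v j (β i)
        -- Discrete product rule: one part is a descent step, the other the slope of the cutoff.
        have h5 : U i (j + 1) - U i j = s * y + (s - t) * z := by
          simp only [U, hy]
          ring
        have h6 : s ^ 2 * y ^ 2 ≤ 1 * y ^ 2 := by gcongr
        have h7 : (s - t) ^ 2 * z ^ 2 ≤ 4 / ℓ ^ 2 * z ^ 2 := by gcongr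
        rw [h5, Pi.sub_apply, ← hy]
        have h8 : (8 : ℝ) / ℓ ^ 2 * z ^ 2 = 2 * (4 / ℓ ^ 2 * z ^ 2) := by ring
        rw [h8]
        nlinarith [sq_nonneg (s * y - (s - t) * z)]
      refine (Finset.sum_le_sum fun i _ => h2 i).trans ?_
      rw [Finset.sum_add_distrib, ← Finset.mul_sum, ← Finset.mul_sum]
      have h3 := hinj (v (j + 1) - v j)
      have h4 := (hinj (v j)).trans (descent_dotProduct_le hB hτ hstep ψ j)
      have h5 : (v (j + 1) - v j) ⬝ᵥ (v (j + 1) - v j) = τ ^ 2 * energy (G.induce Γ) (v j) := by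
        rw [hv_succ, ← hBB]
        simp only [neg_dotProduct, dotProduct_neg, smul_dotProduct, dotProduct_smul, smul_eq_mul]
        ring
      rw [h5] at h3
      have h6 : (8 : ℝ) / ℓ ^ 2 * ∑ i, v j (β i) ^ 2 ≤ 8 / ℓ ^ 2 * (ψ ⬝ᵥ ψ) := by gcongr
      linarith
    refine (Finset.sum_le_sum fun j _ => h1 j).trans ?_
    rw [Finset.sum_add_distrib, ← Finset.mul_sum, Finset.sum_const, Finset.card_range, nsmul_eq_mul]
    have hkc' : (k : ℝ) ≤ 2 * c * ℓ := by exact_mod_cast hkc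
    -- Here `k ≤ 2cℓ` cancels the depth `ℓ` and makes the bound independent of the size of the
    -- graph.
    have h2 : (ℓ : ℝ) * (8 / ℓ ^ 2 * (ψ ⬝ᵥ ψ)) ≤ 16 * c * M * Q := by
      calc (ℓ : ℝ) * (8 / ℓ ^ 2 * (ψ ⬝ᵥ ψ)) ≤ ℓ * (8 / ℓ ^ 2 * (2 * c * ℓ * M * Q)) := by
            gcongr
            refine hgap.trans ?_
            gcongr
        _ = _ := by
            field_simp
            ring
    have h3 : 2 * τ ^ 2 * ∑ j ∈ Finset.range ℓ, energy (G.induce Γ) (v j) ≤ Q := by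
      calc _ ≤ 2 * τ ^ 2 * (3 * M * Q) := by gcongr
        _ = 2 * τ * (τ * (3 * M)) * Q := by ring
        _ = 2 * τ * Q := by rw [hτM, mul_one]
        _ ≤ 1 * Q := by
            gcongr
            nlinarith
        _ = Q := one_mul Q
    linarith
  refine (h.energy_extension_le hℓ U m hUm ε fun p hp => by simp [ε, hp]).trans ?_
  rw [Finset.sum_add_distrib, ← Finset.mul_sum, ← Finset.mul_sum]
  have hM2 : (M : ℝ) ^ 2 ≤ M ^ 4 := pow_le_pow_right₀ hM (by norm_num)
  have hM3 : (M : ℝ) ^ 3 ≤ M ^ 4 := pow_le_pow_right₀ hM (by norm_num)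
  calc _ ≤ 27 * M * (12 * M ^ 3 * Q) +
        54 * M ^ 2 * (2 * (12 * M ^ 2 * Q) + 3 * ((1 + 16 * c * M) * Q)) := by gcongr
    _ = (1620 * M ^ 4 + 162 * M ^ 2 + 2592 * c * M ^ 3) * Q := by ring
    _ ≤ (1620 * M ^ 4 + 162 * M ^ 4 + 2592 * c * M ^ 4) * Q := by gcongr
    _ ≤ _ := by
        gcongr
        have : (0 : ℝ) ≤ c * M ^ 4 := by positivity
        have : (0 : ℝ) ≤ M ^ 4 := by positivity
        nlinarith

end IsLabelling

end Extension

/-! ### The boundary in consecutive columns -/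

section Windows

open scoped Classical

namespace IsLabelling

variable {V : Type*} {G : SimpleGraph V} {Γ : Set V} {k ℓ M : ℕ} [NeZero k]
  {col : V → Fin k} {row : V → ℕ}

/-- The vertices in the first row whose column is one of `s, …, s + n`, modulo `k`. -/
def arcSet (col : V → Fin k) (row : V → ℕ) (s n : ℕ) : Set V :=
  {p | row p = 0 ∧ ∃ m ≤ n, col p = Fin.ofNat k (s + m)}

/-- Columns are added one at a time through a horizontal edge; the arc has `n + 1` of them,
repetitions allowed. -/
theorem connected_arcSet (h : IsLabelling G Γ k ℓ M col row) (hℓ : 0 < ℓ) (s n : ℕ) :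
    (G.induce (arcSet col row s n)).Connected := by
  induction n with
  | zero =>
    have : arcSet col row s 0 = cell col row (Fin.ofNat k s) 0 := by
      ext p
      constructor
      · rintro ⟨h1, m, hm, h2⟩
        rw [Nat.le_zero.mp hm] at h2
        exact ⟨h2, h1⟩
      · rintro ⟨h1, h2⟩
        exact ⟨h2, 0, le_rfl, h1⟩
    rw [this]
    exact h.connected _ _ hℓ
  | succ n ih =>
    have hunion : arcSet col row s (n + 1) =
        arcSet col row s n ∪ cell col row (Fin.ofNat k (s + n) + 1) 0 := by
      have hs : Fin.ofNat k (s + n) + 1 = Fin.ofNat k (s + (n + 1)) := by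
        ext
        simp [Fin.val_add, add_assoc]
      rw [hs]
      ext p
      constructor
      · rintro ⟨h1, m, hm, h2⟩
        rcases hm.lt_or_eq with hm | hm
        · exact Or.inl ⟨h1, m, by omega, h2⟩
        · rw [hm] at h2
          exact Or.inr ⟨h2, h1⟩
      · rintro (⟨h1, m, hm, h2⟩ | ⟨h1, h2⟩)
        · exact ⟨h1, m, by omega, h2⟩
        · exact ⟨h2, n + 1, le_rfl, h1⟩
    rw [hunion]
    obtain ⟨p, hp, q, hq, hpq⟩ := h.horizontal (Fin.ofNat k (s + n)) 0 hℓ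
    exact connected_induce_union ih.preconnected (h.connected _ _ hℓ).preconnected
      ⟨hp.2, n, le_rfl, hp.1⟩ hq hpq

/-- The part of the boundary face in two consecutive columns is connected. -/
theorem preconnected_window [Fintype V] (h : IsLabelling G Γ k ℓ M col row) (hℓ : 0 < ℓ)
    (hk : 3 ≤ k) (hG : G.Connected) (R : RotationSystem G) (hR : R.IsPlanar) (d : G.Dart)
    (hΓ : Γ = R.faceVertices d) (i : Fin k) :
    ((G.induce Γ).induce (window Γ col i)).Preconnected := by
  -- All indices stay below `2 * k`, so reduction modulo `k` is at most one subtraction.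
  have hmod : ∀ n < 2 * k, n % k = if n < k then n else n - k := by
    intro n hn
    split_ifs with h1
    · exact Nat.mod_eq_of_lt h1
    · rw [Nat.mod_eq_sub_mod (by omega), Nat.mod_eq_of_lt (by omega)]
  have hi := i.2
  have hval : ∀ (x : Fin k) (n : ℕ), n < 2 * k →
      (x = Fin.ofNat k n ↔ (x : ℕ) = if n < k then n else n - k) := by
    intro x n hn
    rw [Fin.ext_iff, Fin.val_ofNat, hmod n hn]
  -- The columns `i`, `i + 1` against the `k - 2` others, `i + 2` to `i + k - 1`: disjoint connected
  -- sets that cover the face.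
  have hA := (h.connected_arcSet hℓ i 1).preconnected
  have hA' := (h.connected_arcSet hℓ (i + 2) (k - 3)).preconnected
  have hdisj : Disjoint (arcSet col row i 1) (arcSet col row (i + 2) (k - 3)) := by
    rw [Set.disjoint_left]
    rintro p ⟨-, m, hm, h1⟩ ⟨-, m', hm', h2⟩
    rw [hval _ _ (by omega)] at h1 h2
    split_ifs at h1 h2 <;> omega
  have hcov : ∀ v ∈ R.faceVertices d, v ∉ arcSet col row i 1 →
      v ∈ arcSet col row (i + 2) (k - 3) := by
    intro v hv hvA
    rw [← hΓ] at hv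
    have hrow := h.boundary_row v hv
    have hx := (col v).2
    have h0 : col v ≠ Fin.ofNat k (i + 0) := fun h0 => hvA ⟨hrow, 0, by omega, h0⟩
    have h1 : col v ≠ Fin.ofNat k (i + 1) := fun h1 => hvA ⟨hrow, 1, le_rfl, h1⟩
    rw [Ne, hval _ _ (by omega)] at h0 h1
    rcases Nat.lt_or_ge (col v) (i + 2) with hlt | hge
    · refine ⟨hrow, col v + k - i - 2, ?_, ?_⟩
      · split_ifs at h0 h1 <;> omega
      · rw [hval _ _ (by omega)]
        split_ifs at h0 h1 ⊢ <;> omega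
    · refine ⟨hrow, col v - i - 2, by omega, ?_⟩
      rw [hval _ _ (by omega)]
      split_ifs <;> omega
  have := R.preconnected_faceVertices_inter hR hG hA hA' hdisj d hcov
  rw [← hΓ] at this
  have hwin : window Γ col i = {p : Γ | p.1 ∈ arcSet col row i 1} := by
    have hi0 : Fin.ofNat k (i + 0) = i := by ext; simp
    have hi1 : Fin.ofNat k (i + 1) = i + 1 := by ext; simp [Fin.val_add]
    ext p
    constructor
    · rintro (hp | hp)
      · exact ⟨h.boundary_row p p.2, 0, by omega, hp.trans hi0.symm⟩
      · exact ⟨h.boundary_row p p.2, 1, le_rfl, hp.trans hi1.symm⟩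
    · rintro ⟨-, m, hm, hp⟩
      rcases Nat.le_one_iff_eq_zero_or_eq_one.mp hm with rfl | rfl
      · exact Or.inl (hp.trans hi0)
      · exact Or.inr (hp.trans hi1)
  rw [hwin]
  exact this

end IsLabelling

theorem ThreeConnected.connected {V : Type*} {G : SimpleGraph V} (hG : ThreeConnected G) :
    G.Connected := by
  have h1 := hG ∅ (by simp)
  have h2 : {v : V | v ∉ (∅ : Finset V)} = Set.univ := by ext; simp
  rw [h2] at h1
  exact (induceUnivIso G).connected_iff.mp h1

theorem quadForm_sqrtBoundaryLaplacian_nonneg {V : Type*} [Fintype V] (G : SimpleGraph V)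
    (Γ : Set V) (φ : Γ → ℝ) : 0 ≤ quadForm (sqrtBoundaryLaplacian G Γ) φ :=
  form_nonneg (posSemidef_cfc_sqrt _) φ

end Windows

/-! ### The constants -/

section Constants

/-- The denominator lies between `0` and `1 / 6`, because `3 < π < 3.15` and `√2 < 1.415`. -/
theorem upper_constant_le {A : ℝ} (hA : 0 ≤ A) :
    6 * A ≤ A / (1 / (2 * Real.pi) - Real.sqrt 2 / 12) := by
  have h1 := Real.pi_gt_three
  have h2 := Real.pi_lt_d2
  have h3 : Real.sqrt 2 < 1.415 := by
    rw [Real.sqrt_lt' (by norm_num)]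
    norm_num
  have h4 : (0.158 : ℝ) < 1 / (2 * Real.pi) := by
    rw [lt_div_iff₀ (by positivity)]
    linarith
  have h5 : 1 / (2 * Real.pi) ≤ 1 / 6 := by
    apply one_div_le_one_div_of_le <;> linarith
  have h6 : 0 ≤ Real.sqrt 2 := Real.sqrt_nonneg 2
  rw [le_div_iff₀ (by linarith)]
  nlinarith

/-- The maximum dominates both `3c` and `36`, the last factor is at least `1 / 4`, and `36 / 4 = 9`
leaves room for `10 + 8c`. -/
theorem lower_constant_ge {c M : ℝ} (hM : 0 ≤ M) :
    (10 + 8 * c) * M ^ 3 ≤ 36 * M ^ 2 * (M + 3) * max (3 * c) (4 * Real.pi ^ 2) *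
      (2 / (3 * Real.pi) + Real.sqrt 2 / 27) := by
  have h1 := Real.pi_gt_three
  have h2 := Real.pi_lt_d2
  have h3 : (1.4 : ℝ) ≤ Real.sqrt 2 := by
    rw [Real.le_sqrt (by norm_num) (by norm_num)]
    norm_num
  have h4 : (0.2 : ℝ) ≤ 2 / (3 * Real.pi) := by
    rw [le_div_iff₀ (by positivity)]
    linarith
  have h5 : (1 / 4 : ℝ) ≤ 2 / (3 * Real.pi) + Real.sqrt 2 / 27 := by linarith
  have h6 := le_max_left (3 * c) (4 * Real.pi ^ 2)
  have h7 : (36 : ℝ) ≤ max (3 * c) (4 * Real.pi ^ 2) :=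
    le_trans (by nlinarith) (le_max_right (3 * c) (4 * Real.pi ^ 2))
  set m := max (3 * c) (4 * Real.pi ^ 2)
  calc (10 + 8 * c) * M ^ 3 ≤ (9 * m) * M ^ 3 := by
        gcongr
        linarith
    _ = 36 * M ^ 2 * M * m * (1 / 4) := by ring
    _ ≤ _ := by
        gcongr
        linarith

end Constants

end GraphTrace

theorem theorem3p5 {V : Type*} [Fintype V] (G : SimpleGraph V) (Γ : Set V)
    (hG : GraphTrace.IsPlanarPair G Γ)
    (k ℓ c M : ℕ) (hℓ : 2 ≤ ℓ) (hk : 4 * ℓ < k) (hkc : k < 2 * c * ℓ)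
    (H : SimpleGraph (Fin k × Fin ℓ))
    (hH₁ : GraphTrace.annulus k ℓ ≤ H) (hH₂ : H ≤ GraphTrace.annulusStar k ℓ)
    (hagg : GraphTrace.IsAggregation M G Γ H) (φ : Γ → ℝ) :
    1 / (36 * (M : ℝ) ^ 2 * ((M : ℝ) + 3) * max (3 * (c : ℝ)) (4 * Real.pi ^ 2) *
          (2 / (3 * Real.pi) + Real.sqrt 2 / 27)) *
        GraphTrace.quadForm (GraphTrace.sqrtBoundaryLaplacian G Γ) φ
      ≤ GraphTrace.quadForm (GraphTrace.schurComplement G Γ) φ ∧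
    GraphTrace.quadForm (GraphTrace.schurComplement G Γ) φ
      ≤ 784 * (M : ℝ) ^ 4 * (3 * (c : ℝ) + 20) / (1 / (2 * Real.pi) - Real.sqrt 2 / 12) *
        GraphTrace.quadForm (GraphTrace.sqrtBoundaryLaplacian G Γ) φ := by
  have hk0 : NeZero k := ⟨by omega⟩
  have hℓ0 : 0 < ℓ := by omega
  obtain ⟨col, row, h⟩ :=
    GraphTrace.exists_isLabelling (by omega) hℓ0 hH₁ hH₂ hagg
  have hconn := hG.threeConnected.connected
  have hΓ : Γ.Nonempty := by
    obtain ⟨p, hp, -⟩ := h.boundary_col 0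
    exact ⟨p, hp⟩
  obtain ⟨R, hR, d, hd⟩ := hG.exists_face
  have hM : (1 : ℝ) ≤ M := by exact_mod_cast h.one_le hℓ0
  set Q := GraphTrace.quadForm (GraphTrace.sqrtBoundaryLaplacian G Γ) φ with hQ
  have hQ0 : 0 ≤ Q := GraphTrace.quadForm_sqrtBoundaryLaplacian_nonneg G Γ φ
  constructor
  -- The trace inequality is applied to the extension of least energy.
  · obtain ⟨u, hu, hE⟩ := GraphTrace.exists_energy_eq_quadForm hconn hΓ φ
    have h1 := h.sqrt_form_le_energy hℓ0 hkc.le u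
    have h2 : (fun p : Γ => u p) = φ := funext hu
    rw [h2, hE] at h1
    have h1 : Q ≤ (10 + 8 * c) * M ^ 3 *
      GraphTrace.quadForm (GraphTrace.schurComplement G Γ) φ := h1
    have h3 := GraphTrace.lower_constant_ge (c := c) (M := M) (by linarith)
    have hS0 : 0 ≤ GraphTrace.quadForm (GraphTrace.schurComplement G Γ) φ := by
      rw [← hE]
      exact GraphTrace.energy_nonneg _ _
    have hpos : (0 : ℝ) < (10 + 8 * c) * M ^ 3 := by positivity
    rw [one_div_mul_eq_div, div_le_iff₀ (hpos.trans_le h3), mul_comm]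
    exact h1.trans (mul_le_mul_of_nonneg_right h3 hS0)
  · obtain ⟨u, hu, hE⟩ := h.exists_extension hℓ hkc.le
      (fun i => h.preconnected_window hℓ0 (by omega) hconn R hR d hd i) φ
    have h1 := GraphTrace.quadForm_schurComplement_le hconn hΓ u
    have h2 : (fun p : Γ => u p) = φ := funext hu
    rw [h2] at h1
    have hE : GraphTrace.energy G u ≤ (2000 + 3000 * c) * M ^ 4 * Q := hE
    refine (h1.trans hE).trans (mul_le_mul_of_nonneg_right ?_ hQ0)
    refine le_trans ?_ (GraphTrace.upper_constant_le (by positivity))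
    have h3 : (0 : ℝ) ≤ M ^ 4 := by positivity
    have h4 : (0 : ℝ) ≤ c * M ^ 4 := by positivity
    nlinarith
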